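/- Let $\Gamma=(G,\sigma)$ be a signed graph of order $n$, that is, a finite simple graph $G$ with $n$ vertices together with a sign function $\sigma:E(G)\to\{+1,-1\}$, and suppose that every connected component of $G$ has at least two vertices. Let $i_-(\Gamma)$ be the number of negative eigenvalues, counted with multiplicity, of the adjacency matrix of $\Gamma$ (its $(u,v)$ entry is $\sigma(uv)$ if $uv\in E(G)$ and $0$ otherwise), let $p(\Gamma)$ be the number of vertices of degree $1$, and let $\theta(\Gamma)=|E(G)|-|V(G)|+c(G)$, where $c(G)$ is the number of connected components of $G$. A signed graph is called balanced if the product of the edge signs along each of its cycles is $+1$, and unbalanced otherwise. Then $$i_-(\Gamma)=\frac{n-p(\Gamma)}{2}-\theta(\Gamma)$$ if and only if $\Gamma$ is isomorphic, as a signed graph (by a graph isomorphism that preserves the edge signs), to a disjoint union $C_{n_1}^{\sigma}\cup C_{n_2}^{\sigma}\cup\cdots\cup C_{n_t}^{\sigma}$ of signed cycles, where $n_i\ge 3$ is the number of vertices of the $i$-th cycle, $n_1+n_2+\cdots+n_t=n$, and for every $i\in\{1,\ldots,t\}$: $n_i\equiv 0\pmod 4$ if $C_{n_i}^{\sigma}$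 is balanced, and $n_i\equiv 2\pmod 4$ if $C_{n_i}^{\sigma}$ is unbalanced. -/

import Mathlib

/-- A signed graph `Γ = (G, σ)` on the vertex set `V`: a simple graph together with a sign
`+1` or `-1` for every edge. A function on edges is given as a function of an
adjacent pair of vertices that does not depend on the order of the two ends. -/
structure SignedGraph (V : Type*) where
  /-- the underlying graph -/
  graph : SimpleGraph V
  /-- the sign of the edge `uv` -/
  sign : ∀ u v : V, graph.Adj u v → ℤˣ
  sign_comm : ∀ (u v : V) (h : graph.Adj u v), sign u v h = sign v u h.symm

namespace SignedGraph

open scoped Classical in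
/-- The adjacency matrix: the entry at `(u, v)` is the sign of the edge `uv`, and `0` if there
is no such edge. -/
noncomputable def adjMatrix {V : Type*} (Γ : SignedGraph V) : Matrix V V ℝ :=
  Matrix.of fun u v => if h : Γ.graph.Adj u v then ((Γ.sign u v h : ℤ) : ℝ) else 0

theorem isHermitian_adjMatrix {V : Type*} (Γ : SignedGraph V) : Γ.adjMatrix.IsHermitian := by
  ext u v
  by_cases h : Γ.graph.Adj u v
  · simp [adjMatrix, h, h.symm, Γ.sign_comm u v h]
  · have h' : ¬ Γ.graph.Adj v u := fun k => h k.symm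
    simp [adjMatrix, h, h']

open scoped Classical in
/-- The negative inertia index `i₋(Γ)`: the number of negative eigenvalues of the adjacency
matrix, counted with multiplicity. -/
noncomputable def negInertia {V : Type*} [Fintype V] (Γ : SignedGraph V) : ℕ :=
  Nat.card {i : V // Γ.isHermitian_adjMatrix.eigenvalues i < 0}

/-- The number `p(Γ)` of pendant vertices, i.e. of vertices with exactly one neighbour. -/
noncomputable def numPendant {V : Type*} (Γ : SignedGraph V) : ℕ :=
  {v : V | (Γ.graph.neighborSet v).ncard = 1}.ncard

/-- The cyclomatic number `θ(Γ) = |E| - |V| + c`, where `c` is the number of connected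
components. -/
noncomputable def cyclomatic {V : Type*} (Γ : SignedGraph V) : ℤ :=
  (Γ.graph.edgeSet.ncard : ℤ) - (Nat.card V : ℤ) + (Nat.card Γ.graph.ConnectedComponent : ℤ)

/-- The sign of a walk: the product of the signs of the edges it runs through. A cycle
runs through each of its edges exactly once. -/
def walkSign {V : Type*} (Γ : SignedGraph V) {u v : V} (w : Γ.graph.Walk u v) : ℤˣ :=
  (w.darts.map fun d => Γ.sign d.fst d.snd d.adj).prod

/-- A signed graph is balanced if all of its cycles are positive. -/
def Balanced {V : Type*} (Γ : SignedGraph V) : Prop :=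
  ∀ (v : V) (w : Γ.graph.Walk v v), w.IsCycle → Γ.walkSign w = 1

/-- An isomorphism of signed graphs: a bijection of the vertices that preserves adjacency,
non-adjacency and the signs of the edges. -/
structure Iso {V W : Type*} (Γ : SignedGraph V) (Δ : SignedGraph W) where
  /-- the isomorphism of the underlying graphs -/
  toGraphIso : Γ.graph ≃g Δ.graph
  sign_eq : ∀ (u v : V) (h : Γ.graph.Adj u v),
    Δ.sign (toGraphIso u) (toGraphIso v) (toGraphIso.map_rel_iff.2 h) = Γ.sign u v h

/-- The disjoint union of a family of signed graphs: `(i, u)` and `(j, v)` are adjacent if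
and only if `i = j` and `u`, `v` are adjacent in the `i`-th graph, and then the sign is the one
there. -/
def disjointUnion {ι : Type*} {W : ι → Type*} (Γ : ∀ i, SignedGraph (W i)) :
    SignedGraph (Σ i, W i) where
  graph :=
    { Adj := fun x y => ∃ h : x.1 = y.1, (Γ y.1).graph.Adj (h ▸ x.2) y.2
      symm := ⟨by
        rintro ⟨i, u⟩ ⟨j, v⟩ ⟨h, k⟩
        cases h
        exact ⟨rfl, k.symm⟩⟩
      loopless := ⟨by
        rintro ⟨i, u⟩ ⟨h, k⟩
        exact k.ne rfl⟩ }
  sign := fun x y h => (Γ y.1).sign (h.fst ▸ x.2) y.2 h.snd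
  sign_comm := by
    rintro ⟨i, u⟩ ⟨j, v⟩ ⟨h, k⟩
    cases h
    exact (Γ i).sign_comm u v k

/-- A signed graph on `Fin n` is a signed cycle `C_n^σ` if `n ≥ 3` and its underlying graph is
the cycle `0, 1, …, n - 1, 0`. -/
def IsSignedCycle {n : ℕ} (Γ : SignedGraph (Fin n)) : Prop :=
  3 ≤ n ∧ Γ.graph = SimpleGraph.cycleGraph n

end SignedGraph

/-! Multiplied by two, the equality reads `2 i₋ + 2 c + W = 0` with `W = 2|E| - 3n + p`. When no
vertex is isolated, `W` is a sum over the vertices of a function of the degree (`totalWeight`). All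
three terms are additive over components, so the connected case decides: `weight_bound` gives `2 i₋
+ 2 + W ≥ 0`, strictly if some degree is neither `0` nor `2`. Equality for `Γ` therefore forces
equality on every component, and every component is a cycle.

`weight_bound` is proved by induction on the graph, for all real symmetric matrices with that
support. Deleting a non-cut vertex leaves at most one nontrivial component and does not increase
`i₋`; deleting a pendant vertex together with its neighbour lowers `i₋` by at least one. The change
of `W` depends only on the degrees of the deleted vertices and their neighbours.

For a cycle of length `m` the bound says `2 i₋ + 2 ≥ m`. Equality is impossible for odd `m`. For
even `m` the cycle is bipartite, so its spectrum is symmetric and `2 i₋ ≤ m`, with equality exactly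
when the matrix is invertible; thus `2 i₋ + 2 = m` means that the matrix is singular. A kernel
vector satisfies a two-step recurrence around the cycle, which closes up exactly when the product of
the signs is `(-1)^(m/2)`. This is the congruence condition modulo 4. -/

namespace Matrix

/-! ### Negative inertia through subspaces on which the quadratic form is definite. -/

open scoped Classical in
/-- The number of negative eigenvalues of a real symmetric matrix, with multiplicity. -/
noncomputable def negCount {n : Type*} [Fintype n] {A : Matrix n n ℝ} (hA : A.IsHermitian) : ℕ :=
  Nat.card {i : n // hA.eigenvalues i < 0}

section
variable {n : Type*} [Fintype n] [DecidableEq n] {A : Matrix n n ℝ}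

/-- The coordinates of a vector in the orthonormal eigenbasis of a symmetric matrix. -/
noncomputable def eigenCoord (hA : A.IsHermitian) : (n → ℝ) ≃ₗ[ℝ] (n → ℝ) :=
  (WithLp.linearEquiv 2 ℝ (n → ℝ)).symm ≪≫ₗ hA.eigenvectorBasis.repr.toLinearEquiv ≪≫ₗ
    WithLp.linearEquiv 2 ℝ (n → ℝ)

theorem dotProduct_mulVec_eq_sum_eigenCoord (hA : A.IsHermitian) (x : n → ℝ) :
    x ⬝ᵥ A *ᵥ x = ∑ i, hA.eigenvalues i * eigenCoord hA x i ^ 2 := by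
  have h1 : ∀ y : n → ℝ, x ⬝ᵥ y = inner ℝ (WithLp.toLp 2 x) (WithLp.toLp 2 y) := by
    intro y
    simp [PiLp.inner_apply, dotProduct, mul_comm]
  rw [h1, ← hA.eigenvectorBasis.sum_inner_mul_inner]
  refine Finset.sum_congr rfl fun i _ => ?_
  have h2 : eigenCoord hA x i = inner ℝ (hA.eigenvectorBasis i) (WithLp.toLp 2 x) := by
    simp [eigenCoord, OrthonormalBasis.repr_apply_apply]
  have h3 : inner ℝ (hA.eigenvectorBasis i) (WithLp.toLp 2 (A *ᵥ x)) =
      hA.eigenvalues i * eigenCoord hA x i := by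
    have h4 := hA.mulVec_eigenvectorBasis i
    have h5 : ∀ z : EuclideanSpace ℝ n, inner ℝ z (WithLp.toLp 2 (A *ᵥ x)) =
        inner ℝ (WithLp.toLp 2 (A *ᵥ z.ofLp)) (WithLp.toLp 2 x) := by
      intro z
      have : inner ℝ z (WithLp.toLp 2 (A *ᵥ x)) = z.ofLp ⬝ᵥ A *ᵥ x := by
        simp [PiLp.inner_apply, dotProduct, mul_comm]
      rw [this, dotProduct_mulVec, ← mulVec_transpose]
      have h6 : Aᵀ = A := by simpa using hA.eq
      rw [h6]
      simp [PiLp.inner_apply, dotProduct, mul_comm]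
    rw [h5, h4, h2]
    simp [WithLp.toLp_smul, inner_smul_left]
  rw [h3, h2, real_inner_comm]
  ring

end

variable {n : Type*} [Fintype n] {A : Matrix n n ℝ}

/-- A linear map into the negative cone bounds the number of negative eigenvalues from below. -/
theorem finrank_le_negCount (hA : A.IsHermitian) {E : Type*} [AddCommGroup E] [Module ℝ E]
    [FiniteDimensional ℝ E] (f : E →ₗ[ℝ] (n → ℝ)) (hf : ∀ c, c ≠ 0 → f c ⬝ᵥ A *ᵥ f c < 0) :
    Module.finrank ℝ E ≤ negCount hA := by
  classical
  -- A vector whose coordinates at the negative eigenvalues all vanish has nonnegative form, so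
  -- projecting to these coordinates is injective on the image of `f`.
  let g : E →ₗ[ℝ] ({i : n // hA.eigenvalues i < 0} → ℝ) :=
    (LinearMap.funLeft ℝ ℝ Subtype.val) ∘ₗ (eigenCoord hA).toLinearMap ∘ₗ f
  have hg : Function.Injective g := by
    rw [← LinearMap.ker_eq_bot, LinearMap.ker_eq_bot']
    intro c hc
    by_contra hne
    have h := hf c hne
    rw [dotProduct_mulVec_eq_sum_eigenCoord hA] at h
    refine absurd h (not_lt.2 (Finset.sum_nonneg fun i _ => ?_))
    by_cases hi : hA.eigenvalues i < 0
    · have : eigenCoord hA (f c) i = 0 := congrFun hc ⟨i, hi⟩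
      simp [this]
    · exact mul_nonneg (not_lt.1 hi) (sq_nonneg _)
  have h := LinearMap.finrank_le_finrank_of_injective hg
  rw [Module.finrank_fintype_fun_eq_card] at h
  rw [negCount, Nat.card_eq_fintype_card]
  convert h

/-- The number of negative eigenvalues is attained as the dimension of a space mapped into the
negative cone. -/
theorem exists_negDef (hA : A.IsHermitian) : ∃ f : (Fin (negCount hA) → ℝ) →ₗ[ℝ] (n → ℝ),
    ∀ c, c ≠ 0 → f c ⬝ᵥ A *ᵥ f c < 0 := by
  classical
  have hcard : Fintype.card {i : n // hA.eigenvalues i < 0} = negCount hA := by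
    rw [negCount, Nat.card_eq_fintype_card]
  let e := Fintype.equivFinOfCardEq hcard
  let ext : (Fin (negCount hA) → ℝ) →ₗ[ℝ] (n → ℝ) :=
    { toFun := fun c i => if h : hA.eigenvalues i < 0 then c (e ⟨i, h⟩) else 0
      map_add' := by intro x y; ext i; by_cases h : hA.eigenvalues i < 0 <;> simp [h]
      map_smul' := by intro a x; ext i; by_cases h : hA.eigenvalues i < 0 <;> simp [h] }
  refine ⟨(eigenCoord hA).symm.toLinearMap ∘ₗ ext, fun c hc => ?_⟩
  rw [dotProduct_mulVec_eq_sum_eigenCoord hA]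
  have hx : eigenCoord hA (((eigenCoord hA).symm.toLinearMap ∘ₗ ext) c) = ext c := by simp
  rw [hx]
  obtain ⟨j, hj⟩ := Function.ne_iff.1 hc
  refine Finset.sum_neg' (fun i _ => ?_) ⟨(e.symm j).1, Finset.mem_univ _, ?_⟩
  · by_cases h : hA.eigenvalues i < 0
    · exact mul_nonpos_of_nonpos_of_nonneg h.le (sq_nonneg _)
    · simp [ext, h]
  · refine mul_neg_of_neg_of_pos (e.symm j).2 (sq_pos_of_ne_zero ?_)
    simpa [ext, (e.symm j).2] using hj

/-- Linear conditions that force the form to be nonnegative bound the number of negative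
eigenvalues from above. -/
theorem negCount_le_finrank (hA : A.IsHermitian) {F : Type*} [AddCommGroup F] [Module ℝ F]
    [FiniteDimensional ℝ F] (φ : (n → ℝ) →ₗ[ℝ] F) (hφ : ∀ x, φ x = 0 → 0 ≤ x ⬝ᵥ A *ᵥ x) :
    negCount hA ≤ Module.finrank ℝ F := by
  obtain ⟨f, hf⟩ := exists_negDef hA
  have hg : Function.Injective (φ ∘ₗ f) := by
    rw [← LinearMap.ker_eq_bot, LinearMap.ker_eq_bot']
    intro c hc
    by_contra hne
    exact absurd (hf c hne) (not_lt.2 (hφ _ hc))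
  simpa using LinearMap.finrank_le_finrank_of_injective hg

/-- Dual to `exists_negDef`: the conditions are the vanishing of the negative eigencoordinates. Such
conditions can be imposed block by block, which gives the upper bound for block sums. -/
theorem exists_nonneg_of_map_eq_zero (hA : A.IsHermitian) :
    ∃ φ : (n → ℝ) →ₗ[ℝ] (Fin (negCount hA) → ℝ), ∀ x, φ x = 0 → 0 ≤ x ⬝ᵥ A *ᵥ x := by
  classical
  have hcard : Fintype.card {i : n // hA.eigenvalues i < 0} = negCount hA := by
    rw [negCount, Nat.card_eq_fintype_card]
  let e := Fintype.equivFinOfCardEq hcard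
  refine ⟨(LinearMap.funLeft ℝ ℝ fun j => (e.symm j).1) ∘ₗ (eigenCoord hA).toLinearMap,
    fun x hx => ?_⟩
  rw [dotProduct_mulVec_eq_sum_eigenCoord hA]
  refine Finset.sum_nonneg fun i _ => ?_
  by_cases hi : hA.eigenvalues i < 0
  · have : eigenCoord hA x i = 0 := by simpa [LinearMap.funLeft] using congrFun hx (e ⟨i, hi⟩)
    simp [this]
  · exact mul_nonneg (not_lt.1 hi) (sq_nonneg _)

theorem negCount_le_of_forall_form {m : Type*} [Fintype m] {B : Matrix m m ℝ}
    (hA : A.IsHermitian) (hB : B.IsHermitian) (p : (m → ℝ) →ₗ[ℝ] (n → ℝ))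
    (hp : ∀ x, p x ⬝ᵥ A *ᵥ p x = x ⬝ᵥ B *ᵥ x) : negCount hB ≤ negCount hA := by
  obtain ⟨f, hf⟩ := exists_negDef hB
  simpa using finrank_le_negCount hA (p ∘ₗ f) fun c hc => by simpa [hp] using hf c hc

open scoped Classical in
theorem negCount_neg (hA : A.IsHermitian) :
    negCount hA.neg = Nat.card {i : n // 0 < hA.eigenvalues i} := by
  have hq : ∀ x : n → ℝ, x ⬝ᵥ (-A) *ᵥ x = ∑ i, -hA.eigenvalues i * eigenCoord hA x i ^ 2 := by
    intro x
    simp [neg_mulVec, dotProduct_mulVec_eq_sum_eigenCoord hA]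
  refine le_antisymm ?_ ?_
  · have h := negCount_le_finrank hA.neg
      ((LinearMap.funLeft ℝ ℝ (Subtype.val : {i : n // 0 < hA.eigenvalues i} → n)) ∘ₗ
        (eigenCoord hA).toLinearMap) fun x hx => by
      rw [hq]
      refine Finset.sum_nonneg fun i _ => ?_
      by_cases hi : 0 < hA.eigenvalues i
      · have : eigenCoord hA x i = 0 := congrFun hx ⟨i, hi⟩
        simp [this]
      · exact mul_nonneg (by linarith [not_lt.1 hi]) (sq_nonneg _)
    simpa using h
  · let ext : ({i : n // 0 < hA.eigenvalues i} → ℝ) →ₗ[ℝ] (n → ℝ) :=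
      { toFun := fun c i => if h : 0 < hA.eigenvalues i then c ⟨i, h⟩ else 0
        map_add' := by intro x y; ext i; by_cases h : 0 < hA.eigenvalues i <;> simp [h]
        map_smul' := by intro a x; ext i; by_cases h : 0 < hA.eigenvalues i <;> simp [h] }
    have h := finrank_le_negCount hA.neg ((eigenCoord hA).symm.toLinearMap ∘ₗ ext) fun c hc => by
      rw [hq]
      have hx : eigenCoord hA (((eigenCoord hA).symm.toLinearMap ∘ₗ ext) c) = ext c := by simp
      rw [hx]
      obtain ⟨j, hj⟩ := Function.ne_iff.1 hc
      refine Finset.sum_neg' (fun i _ => ?_) ⟨j.1, Finset.mem_univ _, ?_⟩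
      · by_cases h : 0 < hA.eigenvalues i
        · exact mul_nonpos_of_nonpos_of_nonneg (by linarith) (sq_nonneg _)
        · simp [ext, h]
      · refine mul_neg_of_neg_of_pos (by linarith [j.2]) (sq_pos_of_ne_zero ?_)
        simpa [ext, j.2] using hj
    simpa using h

/-- The eigenvalues not counted on the left are the zero ones, and one exists exactly when the
determinant vanishes. -/
theorem negCount_add_negCount_neg_le (hA : A.IsHermitian) :
    negCount hA + negCount hA.neg ≤ Fintype.card n ∧
      (negCount hA + negCount hA.neg < Fintype.card n ↔ ∃ x, x ≠ 0 ∧ A *ᵥ x = 0) := by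
  classical
  have hneg : negCount hA = Nat.card {i // hA.eigenvalues i < 0} := rfl
  have hpos := negCount_neg hA
  rw [Nat.card_eq_fintype_card, Fintype.card_subtype] at hpos hneg
  have hsum : negCount hA + negCount hA.neg +
      (Finset.univ.filter fun i => hA.eigenvalues i = 0).card = Fintype.card n := by
    rw [hneg, hpos, ← Finset.card_union_of_disjoint, ← Finset.card_union_of_disjoint]
    · rw [← Finset.filter_or, ← Finset.filter_or, Finset.filter_true_of_mem]
      · simp
      · intro i _
        rcases lt_trichotomy (hA.eigenvalues i) 0 with h | h | h <;> simp [h]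
    · rw [← Finset.filter_or, Finset.disjoint_filter]
      rintro i - (h | h) <;> linarith
    · rw [Finset.disjoint_filter]
      intro i _ h
      linarith
  have hker : (∃ i, hA.eigenvalues i = 0) ↔ ∃ x, x ≠ 0 ∧ A *ᵥ x = 0 := by
    rw [Matrix.exists_mulVec_eq_zero_iff, hA.det_eq_prod_eigenvalues]
    simp [Finset.prod_eq_zero_iff]
  have hc : (∃ i, hA.eigenvalues i = 0) ↔
      0 < (Finset.univ.filter fun i => hA.eigenvalues i = 0).card := by
    rw [Finset.card_pos]
    simp [Finset.Nonempty]
  rw [← hker, hc]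
  omega

theorem isHermitian_of_apply_comm {n : Type*} {A : Matrix n n ℝ} (h : ∀ i j, A i j = A j i) : A.IsHermitian := by
  ext i j
  simpa using h j i

/-- Deleting rows and columns does not increase the number of negative eigenvalues. -/
theorem negCount_le_of_zero_outside {B : Matrix n n ℝ} (hA : A.IsHermitian) (hB : B.IsHermitian)
    (s : Set n) (h0 : ∀ i j, i ∈ s ∨ j ∈ s → B i j = 0)
    (h1 : ∀ i j, i ∉ s → j ∉ s → B i j = A i j) : negCount hB ≤ negCount hA := by
  classical
  let p : (n → ℝ) →ₗ[ℝ] (n → ℝ) :=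
    { toFun := fun x i => if i ∈ s then 0 else x i
      map_add' := by intro x y; ext i; by_cases h : i ∈ s <;> simp [h]
      map_smul' := by intro a x; ext i; by_cases h : i ∈ s <;> simp [h] }
  refine negCount_le_of_forall_form hA hB p fun x => ?_
  simp only [dotProduct, mulVec, Finset.mul_sum]
  refine Finset.sum_congr rfl fun i _ => Finset.sum_congr rfl fun j _ => ?_
  by_cases hi : i ∈ s
  · simp [p, hi, h0 i j (Or.inl hi)]
  by_cases hj : j ∈ s
  · simp [p, hj, h0 i j (Or.inr hj)]
  simp [p, hi, hj, h1 i j hi hj]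

/-- Deleting a pendant vertex `u` together with its neighbour `v` decreases the number of
negative eigenvalues. -/
theorem negCount_add_one_le_of_pendant {B : Matrix n n ℝ} (hA : A.IsHermitian)
    (hB : B.IsHermitian) {u v : n} (huv : u ≠ v) (hne : A u v ≠ 0)
    (hu : ∀ w, w ≠ v → A u w = 0) (hv : A v v = 0)
    (h0 : ∀ i j, i = u ∨ i = v ∨ j = u ∨ j = v → B i j = 0)
    (h1 : ∀ i j, i ≠ u → i ≠ v → j ≠ u → j ≠ v → B i j = A i j) :
    negCount hB + 1 ≤ negCount hA := by
  classical
  obtain ⟨f, hf⟩ := exists_negDef hB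
  have hsymm : ∀ i j, A i j = A j i := fun i j => by simpa using (hA.apply i j).symm
  let p : (n → ℝ) →ₗ[ℝ] (n → ℝ) :=
    { toFun := fun x i => if i = u ∨ i = v then 0 else x i
      map_add' := by intro x y; ext i; by_cases h : i = u ∨ i = v <;> simp [h]
      map_smul' := by intro a x; ext i; by_cases h : i = u ∨ i = v <;> simp [h] }
  have hpform : ∀ x, p x ⬝ᵥ A *ᵥ p x = x ⬝ᵥ B *ᵥ x := by
    intro x
    simp only [dotProduct, mulVec, Finset.mul_sum]
    refine Finset.sum_congr rfl fun i _ => Finset.sum_congr rfl fun j _ => ?_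
    by_cases hi : i = u ∨ i = v
    · simp [p, hi, h0 i j (by tauto)]
    by_cases hj : j = u ∨ j = v
    · simp [p, hj, h0 i j (by tauto)]
    push Not at hi hj
    simp [p, hi, hj, h1 i j hi.1 hi.2 hj.1 hj.2]
  -- The coefficient of `e_u` is chosen so that its product with `α e_v` cancels the cross term of
  -- `y` and `e_v` and leaves `-2α²`. This makes one extra negative direction, orthogonal to the old
  -- ones.
  let β : (Fin (negCount hB) → ℝ) × ℝ →ₗ[ℝ] ℝ :=
    -(A u v)⁻¹ • (LinearMap.snd ℝ _ _ +
      LinearMap.proj v ∘ₗ A.mulVecLin ∘ₗ p ∘ₗ f ∘ₗ LinearMap.fst ℝ _ _)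
  let F : (Fin (negCount hB) → ℝ) × ℝ →ₗ[ℝ] (n → ℝ) :=
    p ∘ₗ f ∘ₗ LinearMap.fst ℝ _ _ + LinearMap.single ℝ (fun _ => ℝ) v ∘ₗ LinearMap.snd ℝ _ _ +
      LinearMap.single ℝ (fun _ => ℝ) u ∘ₗ β
  have hform : ∀ c, F c ⬝ᵥ A *ᵥ F c = f c.1 ⬝ᵥ B *ᵥ f c.1 - 2 * c.2 ^ 2 := by
    rintro ⟨c, α⟩
    set y := p (f c) with hy
    set b := β (c, α) with hb
    have hF : F (c, α) = y + Pi.single v α + Pi.single u b := by simp [F, hy, hb]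
    have hbv : b * A u v = -(α + (A *ᵥ y) v) := by
      have : b = -(A u v)⁻¹ * (α + (A *ᵥ y) v) := by simp [hb, β, hy]; ring
      rw [this]
      field_simp
    have hyu : y u = 0 := by simp [hy, p]
    have hyv : y v = 0 := by simp [hy, p]
    have hAyu : (A *ᵥ y) u = 0 := by
      simp only [mulVec, dotProduct]
      refine Finset.sum_eq_zero fun w _ => ?_
      by_cases hw : w = v
      · simp [hw, hyv]
      · simp [hu w hw]
    have hcross : ∀ w, y ⬝ᵥ A.col w = (A *ᵥ y) w := by
      intro w
      simp only [dotProduct, mulVec, col_apply]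
      exact Finset.sum_congr rfl fun i _ => by rw [hsymm w i, mul_comm]
    rw [hF]
    simp only [mulVec_add, dotProduct_add, add_dotProduct, single_dotProduct, hAyu, ← hpform,
      mulVec_single]
    simp [hv, hu u huv, hsymm v u, ← hy, hcross, hAyu]
    linear_combination 2 * α * hbv
  have h := finrank_le_negCount hA F fun c hc => by
    rw [hform]
    by_cases h1 : c.1 = 0
    · have h2 : c.2 ≠ 0 := fun h2 => hc (Prod.ext h1 h2)
      simp [h1]
      positivity
    · nlinarith [hf c.1 h1, sq_nonneg c.2]
  simpa using h

end Matrix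

/-! ### Non-cut vertices and degrees under vertex deletion. -/

namespace SimpleGraph

variable {V : Type*} {G : SimpleGraph V} {u v w x y z : V}

/-- The number of neighbours of a vertex. -/
noncomputable def deg (G : SimpleGraph V) (v : V) : ℕ := (G.neighborSet v).ncard

/-- All vertices that are not isolated lie in the same connected component. -/
def SupportConnected (G : SimpleGraph V) : Prop :=
  ∀ u v, u ∈ G.support → v ∈ G.support → G.Reachable u v

/-- The neighbours of `v` are connected to each other in the graph without `v`. -/
def IsNonCut (G : SimpleGraph V) (v : V) : Prop :=
  ∀ x y, G.Adj v x → G.Adj v y → (G.deleteIncidenceSet v).Reachable x y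

theorem Reachable.mem_of_closed {S : Set V} (hS : ∀ x y, x ∈ S → G.Adj x y → y ∈ S)
    (h : G.Reachable x y) (hx : x ∈ S) : y ∈ S := by
  obtain ⟨p⟩ := h
  induction p with
  | nil => exact hx
  | cons hadj _ ih => exact ih (hS _ _ hx hadj)

theorem IsNonCut.reachable_deleteIncidenceSet (hv : G.IsNonCut v) (hx : x ≠ v) (hy : y ≠ v)
    (h : G.Reachable x y) : (G.deleteIncidenceSet v).Reachable x y := by
  -- The set is closed under adjacency: a walk that enters `v` remembers a neighbour already
  -- reached, and `hv` leads from it to the neighbour through which the walk leaves.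
  let S : Set V := {z | (z ≠ v → (G.deleteIncidenceSet v).Reachable x z) ∧
    (z = v → ∃ w, G.Adj v w ∧ (G.deleteIncidenceSet v).Reachable x w)}
  have hS : ∀ a b, a ∈ S → G.Adj a b → b ∈ S := by
    rintro a b ⟨h1, h2⟩ hab
    refine ⟨fun hb => ?_, fun hb => ?_⟩
    · by_cases ha : a = v
      · obtain ⟨w, hw, hr⟩ := h2 ha
        subst ha
        exact hr.trans (hv _ _ hw hab)
      · exact (h1 ha).trans (Adj.reachable (deleteIncidenceSet_adj.2 ⟨hab, ha, hb⟩))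
    · subst hb
      exact ⟨a, hab.symm, h1 hab.ne⟩
  exact (h.mem_of_closed hS ⟨fun _ => Reachable.refl _, fun h => absurd h hx⟩).1 hy

theorem IsNonCut.supportConnected_deleteIncidenceSet (hv : G.IsNonCut v)
    (hG : G.SupportConnected) : (G.deleteIncidenceSet v).SupportConnected := by
  rintro x y ⟨x', hx⟩ ⟨y', hy⟩
  replace hx := deleteIncidenceSet_adj.1 hx
  replace hy := deleteIncidenceSet_adj.1 hy
  exact hv.reachable_deleteIncidenceSet hx.2.1 hy.2.1 (hG _ _ ⟨_, hx.1⟩ ⟨_, hy.1⟩)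

theorem isNonCut_of_neighborSet_subsingleton (h : ∀ x y, G.Adj v x → G.Adj v y → x = y) :
    G.IsNonCut v := fun x y hx hy => h x y hx hy ▸ Reachable.refl _

theorem deg_eq_one_iff : G.deg v = 1 ↔ ∃ w, ∀ x, G.Adj v x ↔ x = w := by
  simp [deg, Set.ncard_eq_one, Set.ext_iff]

theorem deg_eq_two_iff : G.deg v = 2 ↔ ∃ w z, w ≠ z ∧ ∀ x, G.Adj v x ↔ x = w ∨ x = z := by
  simp [deg, Set.ncard_eq_two, Set.ext_iff]

theorem isNonCut_of_deg_eq_one (h : G.deg v = 1) : G.IsNonCut v := by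
  obtain ⟨w, hw⟩ := deg_eq_one_iff.1 h
  exact isNonCut_of_neighborSet_subsingleton fun x y hx hy => by
    rw [(hw x).1 hx, (hw y).1 hy]

theorem deg_cycleGraph {m : ℕ} (hm : 3 ≤ m) (i : Fin m) : (cycleGraph m).deg i = 2 := by
  obtain ⟨k, rfl⟩ := Nat.exists_eq_add_of_le' hm
  rw [deg, Set.ncard_eq_toFinset_card', ← cycleGraph_degree_three_le (v := i)]
  rfl

/-- Along adjacent vertices of degree two, being a non-cut vertex propagates. -/
theorem IsNonCut.of_adj (hv : G.IsNonCut v) (hdv : G.deg v = 2) (hdu : G.deg u = 2)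
    (huv : G.Adj v u) : G.IsNonCut u := by
  obtain ⟨w, hwu, hw⟩ : ∃ w, w ≠ u ∧ ∀ x, G.Adj v x ↔ x = u ∨ x = w := by
    obtain ⟨a, b, hab, h⟩ := deg_eq_two_iff.1 hdv
    rcases (h u).1 huv with rfl | rfl
    · exact ⟨b, hab.symm, h⟩
    · exact ⟨a, hab, fun x => (h x).trans or_comm⟩
  obtain ⟨t, htv, ht⟩ : ∃ t, t ≠ v ∧ ∀ x, G.Adj u x ↔ x = v ∨ x = t := by
    obtain ⟨a, b, hab, h⟩ := deg_eq_two_iff.1 hdu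
    rcases (h v).1 huv.symm with rfl | rfl
    · exact ⟨b, hab.symm, h⟩
    · exact ⟨a, hab, fun x => (h x).trans or_comm⟩
  have hvw : G.Adj v w := (hw w).2 (Or.inr rfl)
  have hut : G.Adj u t := (ht t).2 (Or.inr rfl)
  -- Without `v`, the only possible neighbour of `u` is `t`. So the connection from `t` to `w` that
  -- avoids `v` can avoid `u` as well, and the edge `wv` completes a detour around `u`.
  have hnc : (G.deleteIncidenceSet v).IsNonCut u := by
    refine isNonCut_of_neighborSet_subsingleton fun x y hx hy => ?_
    rw [deleteIncidenceSet_adj] at hx hy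
    rw [((ht x).1 hx.1).resolve_left hx.2.2, ((ht y).1 hy.1).resolve_left hy.2.2]
  have h1 : (G.deleteIncidenceSet v).Reachable t w :=
    (Adj.reachable (deleteIncidenceSet_adj.2 ⟨hut.symm, htv, huv.ne'⟩)).trans (hv u w huv hvw)
  have h2 : (G.deleteIncidenceSet u).Reachable t w := by
    refine (hnc.reachable_deleteIncidenceSet hut.ne' hwu h1).mono fun a b hab => ?_
    simp only [deleteIncidenceSet_adj] at hab ⊢
    tauto
  have h3 : (G.deleteIncidenceSet u).Reachable t v :=
    h2.trans (Adj.reachable (deleteIncidenceSet_adj.2 ⟨hvw.symm, hwu, huv.ne⟩))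
  intro x y hx hy
  rcases (ht x).1 hx with rfl | rfl <;> rcases (ht y).1 hy with rfl | rfl
  · exact Reachable.refl _
  · exact h3.symm
  · exact h3
  · exact Reachable.refl _

/-- A vertex at maximal distance from `x` works: shortest paths from `x` to other vertices cannot
pass through it. -/
theorem exists_isNonCut [Finite V] (hr : x ∈ G.support) :
    ∃ v, v ∈ G.support ∧ G.Reachable x v ∧ G.IsNonCut v := by
  obtain ⟨x', hx'⟩ := hr
  obtain ⟨v, hv, hmax⟩ := Set.exists_max_image {v | G.Reachable x v} (G.dist x) (Set.toFinite _)
    ⟨x, Reachable.refl _⟩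
  have hvx : 0 < G.dist x v := by
    have h1 := hmax x' hx'.reachable
    have h2 := hx'.reachable.pos_dist_of_ne hx'.ne
    omega
  have hne : x ≠ v := by
    rintro rfl
    simp at hvx
  refine ⟨v, ?_, hv, ?_⟩
  · obtain ⟨p⟩ := Reachable.symm hv
    cases p with
    | nil => exact absurd rfl hne
    | cons h _ => exact ⟨_, h⟩
  · have key : ∀ k y, y ≠ v → G.Reachable x y → G.dist x y = k → k ≤ G.dist x v →
        (G.deleteIncidenceSet v).Reachable x y := by
      intro k
      induction k with
      | zero =>
        intro y _ hxy h0 _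
        rw [hxy.dist_eq_zero_iff.1 h0]
      | succ k ih =>
        intro y hyv hxy hd hk
        obtain ⟨p, hp⟩ := hxy.symm.exists_walk_length_eq_dist
        rw [dist_comm, hd] at hp
        cases p with
        | nil => simp at hp
        | @cons _ z _ hadj q =>
          have hq : q.length = k := by simpa using hp
          have hzk : G.dist x z ≤ k := by
            rw [dist_comm, ← hq]
            exact dist_le q
          have hxz : G.Reachable x z := hxy.trans hadj.reachable
          have hz : G.dist x z = k := by
            have h1 := hadj.symm.reachable.dist_triangle_right x
            rw [dist_eq_one_iff_adj.2 hadj.symm] at h1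
            omega
          have hzv : z ≠ v := by
            rintro rfl
            omega
          exact (ih z hzv hxz hz (by omega)).trans
            (Adj.reachable (deleteIncidenceSet_adj.2 ⟨hadj.symm, hzv, hyv⟩))
    intro a b ha hb
    have hxa := hv.trans ha.reachable
    have hxb := hv.trans hb.reachable
    exact (key _ a ha.ne' hxa rfl (hmax a hxa)).symm.trans (key _ b hb.ne' hxb rfl (hmax b hxb))

theorem deg_deleteIncidenceSet_of_not_adj (hne : w ≠ v) (h : ¬ G.Adj v w) :
    (G.deleteIncidenceSet v).deg w = G.deg w := by
  have : (G.deleteIncidenceSet v).neighborSet w = G.neighborSet w := by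
    ext x
    simp only [mem_neighborSet, deleteIncidenceSet_adj]
    refine ⟨fun h => h.1, fun hx => ⟨hx, hne, ?_⟩⟩
    rintro rfl
    exact h hx.symm
  rw [deg, this, deg]

theorem deleteIncidenceSet_lt (h : v ∈ G.support) : G.deleteIncidenceSet v < G := by
  obtain ⟨w, h⟩ := h
  refine lt_of_le_of_ne (G.deleteIncidenceSet_le v) fun he => ?_
  rw [← he] at h
  exact (deleteIncidenceSet_adj.1 h).2.1 rfl

section Finite

variable [Finite V]

theorem deg_pos_iff : 0 < G.deg v ↔ v ∈ G.support := by
  rw [deg, Set.ncard_pos]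
  rfl

theorem deg_deleteIncidenceSet_self : (G.deleteIncidenceSet v).deg v = 0 := by
  rw [← Nat.le_zero, ← not_lt, deg_pos_iff]
  rintro ⟨w, h⟩
  exact (deleteIncidenceSet_adj.1 h).2.1 rfl

theorem deg_deleteIncidenceSet_of_adj (h : G.Adj v w) :
    (G.deleteIncidenceSet v).deg w + 1 = G.deg w := by
  have : (G.deleteIncidenceSet v).neighborSet w = G.neighborSet w \ {v} := by
    ext x
    simp [deleteIncidenceSet_adj, h.ne']
  rw [deg, this]
  exact Set.ncard_sdiff_singleton_add_one h.symm

/-- Some vertex of the component is non-cut, and `IsNonCut.of_adj` spreads this along the edges to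
`v`. -/
theorem isNonCut_of_reachable_of_two_regular (hG : ∀ v, G.deg v = 0 ∨ G.deg v = 2)
    (hv : v ∈ G.support) : G.IsNonCut v := by
  obtain ⟨w, hw, hr, hnc⟩ := exists_isNonCut hv
  have h2 : ∀ z, z ∈ G.support → G.deg z = 2 := fun z hz =>
    (hG z).resolve_left (deg_pos_iff.2 hz).ne'
  refine (hr.symm.mem_of_closed (S := {z | z ∈ G.support ∧ G.IsNonCut z}) ?_ ⟨hw, hnc⟩).2
  rintro a b ⟨ha, hna⟩ hab
  have hb : b ∈ G.support := ⟨a, hab.symm⟩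
  exact ⟨hb, hna.of_adj (h2 a ha) (h2 b hb) hab⟩

/-- Otherwise every non-cut vertex has degree two or zero and no neighbour of degree at least three.
Starting from a non-cut vertex in the component of `z`, the property "degree two and non-cut" then
spreads until it reaches `z`. -/
theorem exists_isNonCut_of_three_le_deg (h1 : ∀ v, G.deg v ≠ 1) (hz : 3 ≤ G.deg z) :
    ∃ v, G.IsNonCut v ∧ (3 ≤ G.deg v ∨ G.deg v = 2 ∧ ∃ w, G.Adj v w ∧ 3 ≤ G.deg w) := by
  by_contra! hno
  have hzs : z ∈ G.support := deg_pos_iff.1 (by omega)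
  obtain ⟨w, hw, hr, hnc⟩ := exists_isNonCut hzs
  have hcl := hr.symm.mem_of_closed (S := {v | G.deg v = 2 ∧ G.IsNonCut v}) ?_ ?_
  · have : G.deg z = 2 := hcl.1
    omega
  · rintro a b ⟨ha, hna⟩ hab
    have hb : 0 < G.deg b := deg_pos_iff.2 ⟨a, hab.symm⟩
    have hb3 := (hno a hna).2 ha b hab
    have hb1 := h1 b
    have hb2 : G.deg b = 2 := by omega
    exact ⟨hb2, hna.of_adj ha hb2 hab⟩
  · have hw0 := deg_pos_iff.2 hw
    have hw1 := h1 w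
    have hw3 := (hno w hnc).1
    exact ⟨by omega, hnc⟩

end Finite

/-! ### The degree weight and its change under vertex deletion. -/

/-- The contribution of a vertex of degree `d` to `2 (|E| - n) - k`, where `n` is the number of
vertices that are not isolated and `k` the number of vertices of degree at least two. -/
def degWeight : ℕ → ℤ
  | 0 => 0
  | 1 => -1
  | d + 2 => d - 1

theorem degWeight_of_two_le {d : ℕ} (h : 2 ≤ d) : degWeight d = d - 3 := by
  obtain ⟨d, rfl⟩ := Nat.exists_eq_add_of_le' h
  simp only [degWeight]
  push_cast
  ring

/-- The change of `degWeight` when a vertex loses a neighbour. -/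
def degWeightDrop (d : ℕ) : ℤ := degWeight d - degWeight (d - 1)

/-- Together with the drop `0` in degree two this makes all drops nonnegative except in degree one,
where the drop is `-1`. Pendant vertices therefore need separate treatment. -/
theorem degWeightDrop_of_three_le {d : ℕ} (h : 3 ≤ d) : degWeightDrop d = 1 := by
  rw [degWeightDrop, degWeight_of_two_le (by omega), degWeight_of_two_le (by omega)]
  omega

theorem degWeightDrop_two : degWeightDrop 2 = 0 := rfl

section Fintype

variable [Fintype V]

/-- The sum of the weights of the degrees. -/
noncomputable def totalWeight (G : SimpleGraph V) : ℤ := ∑ v, degWeight (G.deg v)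

theorem totalWeight_eq_zero (h : ∀ x y, ¬ G.Adj x y) : G.totalWeight = 0 := by
  refine Finset.sum_eq_zero fun v _ => ?_
  have : G.deg v = 0 := by
    rw [← Nat.le_zero, ← not_lt, deg_pos_iff]
    rintro ⟨w, hw⟩
    exact h _ _ hw
  rw [this]
  rfl

open scoped Classical in
theorem totalWeight_eq_deleteIncidenceSet (G : SimpleGraph V) (v : V) :
    G.totalWeight = (G.deleteIncidenceSet v).totalWeight + degWeight (G.deg v) +
      ∑ w with G.Adj v w, degWeightDrop (G.deg w) := by
  have h : ∀ w, degWeight (G.deg w) = degWeight ((G.deleteIncidenceSet v).deg w) +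
      (if w = v then degWeight (G.deg v) else 0) +
      if G.Adj v w then degWeightDrop (G.deg w) else 0 := by
    intro w
    by_cases hw : w = v
    · subst hw
      simp [deg_deleteIncidenceSet_self, degWeight]
    by_cases ha : G.Adj v w
    · have := deg_deleteIncidenceSet_of_adj ha
      have h' : (G.deleteIncidenceSet v).deg w = G.deg w - 1 := by omega
      simp [hw, ha, h', degWeightDrop]
    · simp [hw, ha, deg_deleteIncidenceSet_of_not_adj hw ha]
  rw [totalWeight, Finset.sum_congr rfl fun w _ => h w, Finset.sum_add_distrib,
    Finset.sum_add_distrib, Finset.sum_filter]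
  simp [totalWeight]

theorem totalWeight_eq_of_deg_eq_one (hv : ∀ x, G.Adj v x ↔ x = w) :
    G.totalWeight = (G.deleteIncidenceSet v).totalWeight - 1 + degWeightDrop (G.deg w) := by
  classical
  rw [G.totalWeight_eq_deleteIncidenceSet v, deg_eq_one_iff.2 ⟨w, hv⟩]
  have h : (Finset.univ.filter fun x => G.Adj v x) = {w} := by
    ext x
    simp [hv]
  rw [h, Finset.sum_singleton]
  rfl

theorem card_filter_adj [DecidablePred (G.Adj v)] :
    (Finset.univ.filter (G.Adj v)).card = G.deg v := by
  rw [deg, ← Set.ncard_coe_finset]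
  congr 1
  ext x
  simp

end Fintype

end SimpleGraph

/-! ### The lower bound for weighted graphs with one nontrivial component. -/

namespace SimpleGraph

variable {V : Type*} {G : SimpleGraph V} {u v w : V} {A : Matrix V V ℝ}

/-- The nonzero entries of the matrix `A` are the edges of `G`. -/
def IsSupportOf (G : SimpleGraph V) (A : Matrix V V ℝ) : Prop := ∀ u v, A u v ≠ 0 ↔ G.Adj u v

open scoped Classical in
/-- The matrix `A` with the row and the column of `v` replaced by `0`. -/
noncomputable def _root_.Matrix.zeroAt (A : Matrix V V ℝ) (v : V) : Matrix V V ℝ :=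
  Matrix.of fun i j => if i = v ∨ j = v then 0 else A i j

theorem _root_.Matrix.IsHermitian.zeroAt (hA : A.IsHermitian) (v : V) :
    (A.zeroAt v).IsHermitian := by
  refine Matrix.isHermitian_of_apply_comm fun i j => ?_
  have h : A i j = A j i := by simpa using (hA.apply i j).symm
  by_cases hi : i = v <;> by_cases hj : j = v <;> simp [Matrix.zeroAt, hi, hj, h]

theorem IsSupportOf.zeroAt (h : G.IsSupportOf A) (v : V) :
    (G.deleteIncidenceSet v).IsSupportOf (A.zeroAt v) := by
  intro i j
  have := h i j
  rw [deleteIncidenceSet_adj]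
  simp only [Matrix.zeroAt, Matrix.of_apply, ← this]
  split_ifs with h' <;> tauto

theorem SupportConnected.mem_of_closed {S : Set V} (hG : G.SupportConnected)
    (hS : ∀ x y, x ∈ S → G.Adj x y → y ∈ S) (hu : u ∈ S) (hus : u ∈ G.support)
    (hv : v ∈ G.support) : v ∈ S :=
  (hG u v hus hv).mem_of_closed hS hu

variable [Fintype V]

theorem _root_.Matrix.IsHermitian.negCount_zeroAt_le (hA : A.IsHermitian) (v : V) :
    Matrix.negCount (hA.zeroAt v) ≤ Matrix.negCount hA := by
  refine Matrix.negCount_le_of_zero_outside hA _ {v} ?_ ?_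
  · intro i j h
    simpa [Matrix.zeroAt] using fun h1 h2 => absurd h (by simp [h1, h2])
  · intro i j hi hj
    simp only [Set.mem_singleton_iff] at hi hj
    simp [Matrix.zeroAt, hi, hj]

theorem IsSupportOf.negCount_zeroAt_zeroAt (h : G.IsSupportOf A) (hA : A.IsHermitian)
    (hu : ∀ x, G.Adj u x ↔ x = v) :
    Matrix.negCount ((hA.zeroAt u).zeroAt v) + 1 ≤ Matrix.negCount hA := by
  have huv : G.Adj u v := (hu v).2 rfl
  refine Matrix.negCount_add_one_le_of_pendant hA _ huv.ne ((h u v).2 huv) ?_ ?_ ?_ ?_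
  · intro w hw
    by_contra hne
    exact hw ((hu w).1 ((h u w).1 hne))
  · by_contra hne
    exact G.loopless.irrefl v ((h v v).1 hne)
  · rintro i j (rfl | rfl | rfl | rfl) <;> simp [Matrix.zeroAt]
  · intro i j h1 h2 h3 h4
    simp [Matrix.zeroAt, h1, h2, h3, h4]

open scoped Classical in
theorem one_le_sum_degWeightDrop (h1 : ∀ w, G.deg w ≠ 1)
    (h : ∃ w, G.Adj v w ∧ 3 ≤ G.deg w) :
    1 ≤ ∑ w with G.Adj v w, degWeightDrop (G.deg w) := by
  obtain ⟨w, hw, h3⟩ := h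
  rw [← degWeightDrop_of_three_le h3]
  refine Finset.single_le_sum (f := fun w => degWeightDrop (G.deg w)) (fun x hx => ?_)
    (by simpa using hw)
  have hx0 : 0 < G.deg x := deg_pos_iff.2 ⟨v, (by simpa using hx : G.Adj v x).symm⟩
  have hx1 := h1 x
  obtain hx2 | hx3 : G.deg x = 2 ∨ 3 ≤ G.deg x := by omega
  · simp [hx2, degWeightDrop_two]
  · simp [degWeightDrop_of_three_le hx3]

open scoped Classical in
theorem sum_degWeightDrop_nonneg (h1 : ∀ w, G.deg w ≠ 1) :
    0 ≤ ∑ w with G.Adj v w, degWeightDrop (G.deg w) := by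
  refine Finset.sum_nonneg fun x hx => ?_
  have hx0 : 0 < G.deg x := deg_pos_iff.2 ⟨v, (by simpa using hx : G.Adj v x).symm⟩
  have hx1 := h1 x
  obtain hx2 | hx3 : G.deg x = 2 ∨ 3 ≤ G.deg x := by omega
  · simp [hx2, degWeightDrop_two]
  · simp [degWeightDrop_of_three_le hx3]

open scoped Classical in
theorem sum_degWeightDrop_of_three_le (h : ∀ w, G.Adj v w → 3 ≤ G.deg w) :
    ∑ w with G.Adj v w, degWeightDrop (G.deg w) = G.deg v := by
  rw [Finset.sum_congr rfl fun w hw => degWeightDrop_of_three_le (h w (by simpa using hw)),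
    ← card_filter_adj]
  simp

theorem deg_deleteIncidenceSet_eq_one (h : G.Adj v w) (hw : G.deg w = 2) :
    (G.deleteIncidenceSet v).deg w = 1 := by
  have := deg_deleteIncidenceSet_of_adj h
  omega

/-- The lower bound for the number of negative eigenvalues of a weighted graph with at most one
nontrivial component, which is strict if that component is not a cycle. -/
theorem weight_bound (G : SimpleGraph V) : ∀ (A : Matrix V V ℝ) (hA : A.IsHermitian),
    G.IsSupportOf A → G.SupportConnected →
      0 ≤ 2 * (Matrix.negCount hA : ℤ) + 2 + G.totalWeight ∧
      ((∃ v, G.deg v ≠ 0 ∧ G.deg v ≠ 2) →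
        1 ≤ 2 * (Matrix.negCount hA : ℤ) + 2 + G.totalWeight) := by
  classical
  induction G using WellFoundedLT.induction with
  | _ G ih =>
  intro A hA hGA hG
  by_cases hp : ∃ u, G.deg u = 1
  · suffices h : 1 ≤ 2 * (Matrix.negCount hA : ℤ) + 2 + G.totalWeight from
      ⟨by omega, fun _ => h⟩
    obtain ⟨u, hu1⟩ := hp
    obtain ⟨v, hu⟩ := deg_eq_one_iff.1 hu1
    have huv : G.Adj u v := (hu v).2 rfl
    have hnc := isNonCut_of_deg_eq_one hu1
    have hG1 := hnc.supportConnected_deleteIncidenceSet hG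
    have hlt1 := deleteIncidenceSet_lt (G := G) (v := u) ⟨v, huv⟩
    have hW1 := totalWeight_eq_of_deg_eq_one hu
    have hn1 := hA.negCount_zeroAt_le u
    have hn2 := hGA.negCount_zeroAt_zeroAt hA hu
    have hdv := deg_deleteIncidenceSet_of_adj huv
    have ih1 := ih _ hlt1 _ (hA.zeroAt u) (hGA.zeroAt u) hG1
    have hlt2 : (G.deleteIncidenceSet u).deleteIncidenceSet v < G :=
      lt_of_le_of_lt (deleteIncidenceSet_le _ _) hlt1
    have ih2 := ih _ hlt2 _ ((hA.zeroAt u).zeroAt v) ((hGA.zeroAt u).zeroAt v)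
    obtain hv | hv | hv : G.deg v = 1 ∨ G.deg v = 2 ∨ 3 ≤ G.deg v := by omega
    -- The nontrivial component is a single edge: `W = -2` and there is at least one negative
    -- eigenvalue.
    · obtain ⟨u', hv'⟩ := deg_eq_one_iff.1 hv
      obtain rfl : u = u' := (hv' u).1 huv.symm
      have hmem : ∀ x, x ∈ G.support → x ∈ ({u, v} : Set V) := fun x hx =>
        hG.mem_of_closed (by rintro x y (rfl | rfl) h <;> simp_all) (by simp) ⟨v, huv⟩ hx
      have hW : G.totalWeight = -2 := by
        have h0 : (G.deleteIncidenceSet u).totalWeight = 0 := totalWeight_eq_zero fun x y h => by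
          rw [deleteIncidenceSet_adj] at h
          have hx := (hmem x ⟨y, h.1⟩).resolve_left h.2.1
          have hy := (hmem y ⟨x, h.1.symm⟩).resolve_left h.2.2
          exact h.1.ne (hx.trans hy.symm)
        rw [hW1, h0, hv]
        rfl
      omega
    -- Deleting `u` and `v` costs `2` in the inertia term and changes `W` by `2` minus the drop at
    -- `w`. Only the drop at `w` or strictness of the induction hypothesis has to supply the missing
    -- `1`.
    · have hv2 : (G.deleteIncidenceSet u).deg v = 1 := by omega
      obtain ⟨w, hw⟩ := deg_eq_one_iff.1 hv2
      have hG2 := (isNonCut_of_deg_eq_one hv2).supportConnected_deleteIncidenceSet hG1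
      have hW2 := totalWeight_eq_of_deg_eq_one hw
      have hvw1 := (hw w).2 rfl
      have hvw := deleteIncidenceSet_adj.1 hvw1
      have huw : ¬ G.Adj u w := fun h => hvw.1.ne ((hu w).1 h).symm
      rw [deg_deleteIncidenceSet_of_not_adj hvw.2.2 huw] at hW2
      rw [hv, degWeightDrop_two] at hW1
      have hdw := deg_deleteIncidenceSet_of_adj hvw1
      rw [deg_deleteIncidenceSet_of_not_adj hvw.2.2 huw] at hdw
      obtain hw1 | hw2 | hw3 : G.deg w = 1 ∨ G.deg w = 2 ∨ 3 ≤ G.deg w := by omega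
      · obtain ⟨v', hv'⟩ := deg_eq_one_iff.1 hw1
        obtain rfl : v = v' := (hv' v).1 hvw.1.symm
        have hv3 : ∀ x, G.Adj v x → x = u ∨ x = w := by
          intro x hx
          by_cases hxu : x = u
          · exact Or.inl hxu
          · exact Or.inr ((hw x).1 (deleteIncidenceSet_adj.2 ⟨hx, hvw.2.1, hxu⟩))
        have hmem : ∀ x, x ∈ G.support → x ∈ ({u, v, w} : Set V) := fun x hx =>
          hG.mem_of_closed (by
            rintro x y (rfl | rfl | rfl) h
            · simp [(hu y).1 h]
            · rcases hv3 y h with rfl | rfl <;> simp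
            · simp [(hv' y).1 h]) (by simp) ⟨v, huv⟩ hx
        have h0 : ((G.deleteIncidenceSet u).deleteIncidenceSet v).totalWeight = 0 :=
          totalWeight_eq_zero fun x y h => by
            simp only [deleteIncidenceSet_adj] at h
            have hx := ((hmem x ⟨y, h.1.1⟩).resolve_left h.1.2.1).resolve_left h.2.1
            have hy := ((hmem y ⟨x, h.1.1.symm⟩).resolve_left h.1.2.2).resolve_left h.2.2
            exact h.1.1.ne (hx.trans hy.symm)
        -- The component is a path on three vertices: `W = -3`, and the bound is exactly `1`.
        have hd1 : degWeightDrop 1 = -1 := rfl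
        rw [hw1, hd1] at hW2
        omega
      · have h2 := (ih2 hG2).2 ⟨w, by omega, by omega⟩
        rw [hw2, degWeightDrop_two] at hW2
        omega
      · have h2 := (ih2 hG2).1
        rw [degWeightDrop_of_three_le hw3] at hW2
        omega
    -- Here deleting `u` leaves `W` unchanged, so the strict bound is inherited unless the rest is a
    -- cycle. In that case `v` is deleted too: the inertia gains `2` and the weight loses at most
    -- `1`.
    · rw [degWeightDrop_of_three_le hv] at hW1
      by_cases hbad : ∃ x, (G.deleteIncidenceSet u).deg x ≠ 0 ∧ (G.deleteIncidenceSet u).deg x ≠ 2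
      · have := ih1.2 hbad
        omega
      · have hreg : ∀ x, (G.deleteIncidenceSet u).deg x = 0 ∨
            (G.deleteIncidenceSet u).deg x = 2 := by
          intro x
          by_contra hx
          exact hbad ⟨x, by tauto⟩
        have hv2 : (G.deleteIncidenceSet u).deg v = 2 := (hreg v).resolve_left (by omega)
        have hnc2 := isNonCut_of_reachable_of_two_regular hreg (deg_pos_iff.1 (hv2 ▸ Nat.two_pos))
        have h2 := (ih2 (hnc2.supportConnected_deleteIncidenceSet hG1)).1
        have hW2 := (G.deleteIncidenceSet u).totalWeight_eq_deleteIncidenceSet v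
        have hnn := sum_degWeightDrop_nonneg (G := G.deleteIncidenceSet u) (v := v)
          fun x => by have := hreg x; omega
        have hd2 : degWeight 2 = -1 := rfl
        rw [hv2, hd2] at hW2
        omega
  push Not at hp
  -- A neighbour of degree two becomes pendant after the deletion, so the induction hypothesis is
  -- then strict.
  have step : ∀ v, v ∈ G.support → G.IsNonCut v →
      0 ≤ 2 * (Matrix.negCount hA : ℤ) + 2 + (G.deleteIncidenceSet v).totalWeight ∧
      ((∃ w, G.Adj v w ∧ G.deg w = 2) →
        1 ≤ 2 * (Matrix.negCount hA : ℤ) + 2 + (G.deleteIncidenceSet v).totalWeight) := by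
    intro v hv hnc
    have h := ih _ (deleteIncidenceSet_lt hv) _ (hA.zeroAt v) (hGA.zeroAt v)
      (hnc.supportConnected_deleteIncidenceSet hG)
    have hn := hA.negCount_zeroAt_le v
    refine ⟨by omega, ?_⟩
    rintro ⟨w, hw, hw2⟩
    have := deg_deleteIncidenceSet_eq_one hw hw2
    have := h.2 ⟨w, by omega, by omega⟩
    omega
  by_cases h3 : ∃ z, 3 ≤ G.deg z
  · suffices h : 1 ≤ 2 * (Matrix.negCount hA : ℤ) + 2 + G.totalWeight from
      ⟨by omega, fun _ => h⟩
    obtain ⟨z, hz⟩ := h3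
    obtain ⟨v, hnc, hv⟩ := exists_isNonCut_of_three_le_deg hp hz
    have hv2 : 2 ≤ G.deg v := by omega
    have hs := step v (deg_pos_iff.1 (by omega)) hnc
    have hW := G.totalWeight_eq_deleteIncidenceSet v
    rw [degWeight_of_two_le hv2] at hW
    by_cases h2 : ∃ w, G.Adj v w ∧ G.deg w = 2
    · have hs2 := hs.2 h2
      rcases hv with hv | ⟨hv, hw⟩
      · have := sum_degWeightDrop_nonneg (v := v) hp
        omega
      · have := one_le_sum_degWeightDrop hp hw
        omega
    -- All neighbours have degree at least three, so the deletion of `v` lowers `W` by `2 deg v - 3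
    -- ≥ 1`.
    · rw [sum_degWeightDrop_of_three_le] at hW
      · omega
      · intro w hw
        have h0 : 0 < G.deg w := deg_pos_iff.2 ⟨v, hw.symm⟩
        have h1 := hp w
        have h2' : G.deg w ≠ 2 := fun h => h2 ⟨w, hw, h⟩
        omega
  push Not at h3
  have hreg : ∀ x, G.deg x = 0 ∨ G.deg x = 2 := fun x => by
    have := hp x
    have := h3 x
    omega
  refine ⟨?_, fun ⟨x, h0, h2⟩ => absurd (hreg x) (by tauto)⟩
  by_cases hE : ∃ v w, G.Adj v w
  · obtain ⟨v, w, hvw⟩ := hE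
    have hv : v ∈ G.support := ⟨w, hvw⟩
    have hv2 : G.deg v = 2 := (hreg v).resolve_left (deg_pos_iff.2 hv).ne'
    have hw2 : G.deg w = 2 := (hreg w).resolve_left (deg_pos_iff.2 ⟨v, hvw.symm⟩).ne'
    -- The own weight `-1` of `v` is paid for by the strict bound for the remaining path.
    have hs := (step v hv (isNonCut_of_reachable_of_two_regular hreg hv)).2 ⟨w, hvw, hw2⟩
    have hW := G.totalWeight_eq_deleteIncidenceSet v
    have := sum_degWeightDrop_nonneg (v := v) hp
    rw [degWeight_of_two_le hv2.ge] at hW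
    omega
  · push Not at hE
    rw [totalWeight_eq_zero hE]
    omega

end SimpleGraph

/-! ### Edge signs and signs of walks. -/

namespace SignedGraph

section
variable {V : Type*} (Γ : SignedGraph V) {u v : V}

open scoped Classical in
/-- The sign of the edge `uv`, and `1` if `u` and `v` are not adjacent. -/
noncomputable def edgeSign (u v : V) : ℤˣ := if h : Γ.graph.Adj u v then Γ.sign u v h else 1

theorem edgeSign_of_adj (h : Γ.graph.Adj u v) : Γ.edgeSign u v = Γ.sign u v h := by
  simp [edgeSign, h]

theorem edgeSign_comm (u v : V) : Γ.edgeSign u v = Γ.edgeSign v u := by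
  by_cases h : Γ.graph.Adj u v
  · rw [edgeSign_of_adj _ h, edgeSign_of_adj _ h.symm, Γ.sign_comm]
  · have h' : ¬ Γ.graph.Adj v u := fun k => h k.symm
    simp [edgeSign, h, h']

theorem adjMatrix_of_adj (h : Γ.graph.Adj u v) : Γ.adjMatrix u v = ((Γ.edgeSign u v : ℤ) : ℝ) := by
  simp [adjMatrix, h, edgeSign]

theorem adjMatrix_of_not_adj (h : ¬ Γ.graph.Adj u v) : Γ.adjMatrix u v = 0 := by
  simp [adjMatrix, h]

theorem isSupportOf_adjMatrix : Γ.graph.IsSupportOf Γ.adjMatrix := by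
  intro u v
  by_cases h : Γ.graph.Adj u v
  · simp [Γ.adjMatrix_of_adj h, h]
  · simp [Γ.adjMatrix_of_not_adj h, h]

theorem walkSign_eq_prod_edgeSign (w : Γ.graph.Walk u v) :
    Γ.walkSign w = ∏ i ∈ Finset.range w.length, Γ.edgeSign (w.getVert i) (w.getVert (i + 1)) := by
  induction w with
  | nil => simp [walkSign]
  | cons h p ih =>
    rw [SimpleGraph.Walk.length_cons, Finset.prod_range_succ']
    simp only [SimpleGraph.Walk.getVert_cons_succ, SimpleGraph.Walk.getVert_zero]
    rw [← ih, edgeSign_of_adj _ h]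
    simp [walkSign, mul_comm]

/-- The product telescopes because units of `ℤ` square to one. In particular all closed walks are
positive. -/
theorem walkSign_eq_of_potential (φ : V → ℤˣ)
    (hφ : ∀ u v, Γ.graph.Adj u v → Γ.edgeSign u v = φ u * φ v) (w : Γ.graph.Walk u v) :
    Γ.walkSign w = φ u * φ v := by
  induction w with
  | nil => simp [walkSign]
  | @cons a b c h p ih =>
    have h1 : Γ.walkSign (SimpleGraph.Walk.cons h p) = Γ.sign a b h * Γ.walkSign p := by
      simp [walkSign]
    rw [h1, ih, ← edgeSign_of_adj _ h, hφ _ _ h]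
    have := Int.units_mul_self (φ b)
    calc φ a * φ b * (φ b * φ c) = φ a * (φ b * φ b) * φ c := by simp only [mul_assoc]
      _ = _ := by rw [this, mul_one]

end

/-! ### Signed cycles: balance, kernel and inertia. -/

section Cycle

open Matrix

variable {k : ℕ}

theorem ofNat_add_one (i : ℕ) : Fin.ofNat (k + 3) i + 1 = Fin.ofNat (k + 3) (i + 1) := by
  ext
  simp [Fin.val_add]

theorem ofNat_add_self (i : ℕ) : Fin.ofNat (k + 3) (i + (k + 3)) = Fin.ofNat (k + 3) i := by
  ext
  simp

theorem ofNat_val (u : Fin (k + 3)) : Fin.ofNat (k + 3) u.val = u := by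
  ext
  simp

variable (C : SignedGraph (Fin (k + 3)))

/-- The sign of the edge from `i` to `i + 1` of a signed cycle, with `i` read modulo the length. -/
noncomputable def cycleSign (i : ℕ) : ℤˣ :=
  C.edgeSign (Fin.ofNat (k + 3) i) (Fin.ofNat (k + 3) (i + 1))

theorem cycleSign_add_self (i : ℕ) : C.cycleSign (i + (k + 3)) = C.cycleSign i := by
  rw [cycleSign, cycleSign, ofNat_add_self, add_right_comm, ofNat_add_self]

theorem prod_cycleSign_period (l : ℕ) :
    ∏ i ∈ Finset.range (k + 3), C.cycleSign (l + i) =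
      ∏ i ∈ Finset.range (k + 3), C.cycleSign i := by
  induction l with
  | zero => simp
  | succ l ih =>
    have h1 : C.cycleSign (l + 1 + (k + 2)) = C.cycleSign (l + 0) := by
      rw [← cycleSign_add_self C (l + 0), add_zero, add_assoc, add_comm 1]
    have h2 : ∀ i, C.cycleSign (l + 1 + i) = C.cycleSign (l + (i + 1)) := fun i => by
      rw [add_assoc, add_comm 1 i]
    rw [← ih, Finset.prod_range_succ, Finset.prod_range_succ' (fun i => C.cycleSign (l + i)), h1]
    simp only [h2]

variable {C}

theorem IsSignedCycle.adj_iff (hC : C.IsSignedCycle) {u v : Fin (k + 3)} :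
    C.graph.Adj u v ↔ v = u + 1 ∨ u = v + 1 := by
  rw [hC.2, SimpleGraph.cycleGraph_adj, sub_eq_iff_eq_add', sub_eq_iff_eq_add', add_comm u,
    add_comm v, or_comm, add_comm 1 u, add_comm 1 v]

theorem IsSignedCycle.deg_eq_two (hC : C.IsSignedCycle) (v : Fin (k + 3)) :
    C.graph.deg v = 2 := by
  rw [hC.2]
  exact SimpleGraph.deg_cycleGraph hC.1 v

theorem IsSignedCycle.totalWeight_eq (hC : C.IsSignedCycle) :
    C.graph.totalWeight = -(k + 3 : ℕ) := by
  simp [SimpleGraph.totalWeight, hC.deg_eq_two, SimpleGraph.degWeight]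

theorem IsSignedCycle.balanced_iff (hC : C.IsSignedCycle) :
    C.Balanced ↔ ∏ i ∈ Finset.range (k + 3), C.cycleSign i = 1 := by
  constructor
  · intro h
    have h1 := h 0 ((SimpleGraph.cycleGraph.cycle k).mapLe hC.2.ge)
      (SimpleGraph.cycleGraph.isCycle_cycle.mapLe _)
    -- The standard closed walk runs through the vertices downwards, hence the reflection of the
    -- index.
    rw [walkSign_eq_prod_edgeSign, ← Finset.prod_range_reflect] at h1
    simp only [SimpleGraph.Walk.length_map, SimpleGraph.cycleGraph.length_cycle] at h1
    rw [← h1]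
    refine Finset.prod_congr rfl fun i hi => ?_
    have hi' := Finset.mem_range.1 hi
    have e1 : k + 3 - 1 - i + 1 = k + 3 - i := by omega
    have e2 : k + 3 - (k + 3 - i) = i := by omega
    have e3 : k + 3 - (k + 3 - 1 - i) = i + 1 := by omega
    rw [cycleSign, edgeSign_comm, e1]
    congr 1
    · rw [SimpleGraph.Walk.getVert_map, SimpleGraph.cycleGraph.getVert_cycle (by omega)]
      simp only [e3]
      rfl
    · rw [SimpleGraph.Walk.getVert_map, SimpleGraph.cycleGraph.getVert_cycle (by omega)]
      simp only [e2]
      rfl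
  · intro h v w _
    -- Partial products of the signs; they descend to the vertices because the full product is one,
    -- and so give a potential.
    let Φ : ℕ → ℤˣ := fun l => ∏ i ∈ Finset.range l, C.cycleSign i
    have hper : Φ.Periodic (k + 3) := by
      intro l
      have : Φ (l + (k + 3)) = Φ l * ∏ i ∈ Finset.range (k + 3), C.cycleSign (l + i) :=
        Finset.prod_range_add _ _ _
      rw [this, prod_cycleSign_period, h, mul_one]
    have hmod : ∀ l, Φ (Fin.ofNat (k + 3) l).val = Φ l := fun l => by
      simpa using hper.map_mod_nat l
    have hstep : ∀ u : Fin (k + 3), C.edgeSign u (u + 1) = Φ u.val * Φ (u + 1).val := by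
      intro u
      have h1 : u + 1 = Fin.ofNat (k + 3) (u.val + 1) := by rw [← ofNat_add_one, ofNat_val]
      have h2 : C.edgeSign u (u + 1) = C.cycleSign u.val := by rw [cycleSign, ofNat_val, h1]
      rw [h2, h1, hmod]
      simp only [Φ, Finset.prod_range_succ]
      rw [← mul_assoc, Int.units_mul_self, one_mul]
    rw [C.walkSign_eq_of_potential (fun u => Φ u.val) ?_ w, Int.units_mul_self]
    intro u v huv
    rcases hC.adj_iff.1 huv with rfl | rfl
    · exact hstep u
    · rw [edgeSign_comm, hstep, mul_comm]

theorem IsSignedCycle.adjMatrix_mulVec (hC : C.IsSignedCycle) (x : Fin (k + 3) → ℝ) (i : ℕ) :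
    (C.adjMatrix *ᵥ x) (Fin.ofNat (k + 3) (i + 1)) =
      ((C.cycleSign (i + 1) : ℤ) : ℝ) * x (Fin.ofNat (k + 3) (i + 2)) +
        ((C.cycleSign i : ℤ) : ℝ) * x (Fin.ofNat (k + 3) i) := by
  have hne : Fin.ofNat (k + 3) (i + 2) ≠ Fin.ofNat (k + 3) i := by
    rw [← ofNat_add_one, ← ofNat_add_one, add_assoc, Ne, add_eq_left]
    exact ne_of_beq_false rfl
  have h1 : C.graph.Adj (Fin.ofNat (k + 3) (i + 1)) (Fin.ofNat (k + 3) (i + 2)) :=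
    hC.adj_iff.2 (Or.inl (ofNat_add_one _).symm)
  have h2 : C.graph.Adj (Fin.ofNat (k + 3) (i + 1)) (Fin.ofNat (k + 3) i) :=
    hC.adj_iff.2 (Or.inr (ofNat_add_one _).symm)
  rw [mulVec, dotProduct, Finset.sum_eq_add _ _ hne]
  · rw [C.adjMatrix_of_adj h1, C.adjMatrix_of_adj h2, cycleSign, cycleSign,
      C.edgeSign_comm (Fin.ofNat (k + 3) (i + 1)) (Fin.ofNat (k + 3) i)]
  · rintro j - ⟨hj1, hj2⟩
    rw [C.adjMatrix_of_not_adj, zero_mul]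
    rw [hC.adj_iff, ofNat_add_one, ← ofNat_add_one i, add_left_inj]
    rintro (h | h)
    · exact hj1 h
    · exact hj2 h.symm
  · simp
  · simp

/-- Row `i + 1` involves only `x` at `i` and `i + 2`; multiplying by the sign at `i + 1` solves for
the latter. -/
theorem IsSignedCycle.mulVec_eq_zero_iff (hC : C.IsSignedCycle) (x : Fin (k + 3) → ℝ) :
    C.adjMatrix *ᵥ x = 0 ↔ ∀ i, x (Fin.ofNat (k + 3) (i + 2)) =
      -(((C.cycleSign i * C.cycleSign (i + 1) : ℤˣ) : ℤ) : ℝ) * x (Fin.ofNat (k + 3) i) := by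
  have hsq : ∀ i, ((C.cycleSign i : ℤ) : ℝ) * ((C.cycleSign i : ℤ) : ℝ) = 1 := fun i => by
    rw [← Int.cast_mul, ← Units.val_mul, Int.units_mul_self]
    simp
  constructor
  · intro h i
    have h1 := hC.adjMatrix_mulVec x i
    rw [h, Pi.zero_apply] at h1
    push_cast
    linear_combination (-((C.cycleSign (i + 1) : ℤ) : ℝ)) * h1 -
      x (Fin.ofNat (k + 3) (i + 2)) * hsq (i + 1)
  · intro h
    ext j
    -- Adding a full period writes every vertex, `0` included, as a successor.
    have hj : j = Fin.ofNat (k + 3) (j.val + (k + 2) + 1) := by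
      rw [add_assoc, ofNat_add_self, ofNat_val]
    rw [hj, hC.adjMatrix_mulVec, h, Pi.zero_apply]
    push_cast
    linear_combination (-((C.cycleSign (j.val + (k + 2)) : ℤ) : ℝ)) *
      x (Fin.ofNat (k + 3) (j.val + (k + 2))) * hsq (j.val + (k + 2) + 1)

theorem IsSignedCycle.exists_mulVec_eq_zero_iff (hC : C.IsSignedCycle) {p : ℕ}
    (hp : k + 3 = 2 * p) : (∃ x, x ≠ 0 ∧ C.adjMatrix *ᵥ x = 0) ↔
      ∏ i ∈ Finset.range (k + 3), C.cycleSign i = (-1) ^ p := by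
  set P := ∏ i ∈ Finset.range (k + 3), C.cycleSign i with hP
  constructor
  · rintro ⟨x, hx, h0⟩
    rw [hC.mulVec_eq_zero_iff] at h0
    -- For `q = p` the recurrence has gone once around and returns to its starting entry, which
    -- fixes the accumulated factor to be `1`.
    have hrun : ∀ l q, x (Fin.ofNat (k + 3) (l + 2 * q)) =
        (((-1) ^ q * ∏ i ∈ Finset.range (2 * q), C.cycleSign (l + i) : ℤˣ) : ℤ) *
          x (Fin.ofNat (k + 3) l) := by
      intro l q
      induction q with
      | zero => simp
      | succ q ih =>
        rw [show l + 2 * (q + 1) = l + 2 * q + 2 by ring, h0, ih,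
          show 2 * (q + 1) = 2 * q + 1 + 1 by ring, Finset.prod_range_succ, Finset.prod_range_succ]
        push_cast
        ring_nf
    obtain ⟨j, hj⟩ := Function.ne_iff.1 hx
    have h1 := hrun j.val p
    rw [← hp, ofNat_add_self, ofNat_val, prod_cycleSign_period, ← hP] at h1
    have h2 : ((((-1) ^ p * P : ℤˣ) : ℤ) : ℝ) = 1 :=
      mul_right_cancel₀ (b := x j) hj (by rw [one_mul]; exact h1.symm)
    have h3 : (-1) ^ p * P = 1 := Units.ext (Int.cast_eq_one.1 h2)
    exact (mul_eq_one_iff_inv_eq.1 h3).symm.trans (Int.units_inv_eq_self _)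
  · intro hPp
    -- The solution of the recurrence with value `1` at `0`, extended by zero to the odd positions;
    -- parity is well defined because the length is even.
    let X : ℕ → ℝ := fun l => if Even l then
      (((-1) ^ (l / 2) * ∏ i ∈ Finset.range l, C.cycleSign i : ℤˣ) : ℤ) else 0
    have hper : X.Periodic (k + 3) := by
      intro l
      have hev : Even (l + (k + 3)) ↔ Even l := by
        rw [hp]
        simp [Nat.even_add]
      have h1 : (l + (k + 3)) / 2 = l / 2 + p := by omega
      have h2 : ((-1) ^ ((l + (k + 3)) / 2) * ∏ i ∈ Finset.range (l + (k + 3)), C.cycleSign i : ℤˣ) =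
          (-1) ^ (l / 2) * ∏ i ∈ Finset.range l, C.cycleSign i := by
        rw [Finset.prod_range_add, prod_cycleSign_period, ← hP, hPp, h1, pow_add,
          mul_mul_mul_comm, Int.units_mul_self, mul_one]
      simp only [X, hev, h2]
    have hmod : ∀ l, X (Fin.ofNat (k + 3) l).val = X l := fun l => by
      simpa using hper.map_mod_nat l
    refine ⟨fun j => X j.val, ?_, (hC.mulVec_eq_zero_iff _).2 fun i => ?_⟩
    · intro h
      have := congrFun h 0
      simp [X] at this
    · rw [hmod, hmod]
      by_cases hi : Even i
      · have hi2 : Even (i + 2) := hi.add (by decide)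
        have h1 : (i + 2) / 2 = i / 2 + 1 := by omega
        simp only [X, hi, hi2, if_true, h1, Finset.prod_range_succ, pow_succ]
        push_cast
        ring
      · have hi2 : ¬ Even (i + 2) := by simpa [Nat.even_add] using hi
        simp [X, hi, hi2]

theorem negInertia_eq (Γ : SignedGraph (Fin (k + 3))) :
    Γ.negInertia = negCount Γ.isHermitian_adjMatrix := rfl

/-- An even cycle is bipartite: changing the sign of every second coordinate turns the form into its
negative. -/
theorem IsSignedCycle.negCount_neg_eq (hC : C.IsSignedCycle) (hk : Even (k + 3)) :
    negCount C.isHermitian_adjMatrix.neg = C.negInertia := by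
  let D : (Fin (k + 3) → ℝ) →ₗ[ℝ] (Fin (k + 3) → ℝ) :=
    { toFun := fun x i => (-1) ^ i.val * x i
      map_add' := by intro x y; ext i; simp [mul_add]
      map_smul' := by intro a x; ext i; simp [mul_left_comm] }
  have hD : ∀ x, D x ⬝ᵥ C.adjMatrix *ᵥ D x = x ⬝ᵥ (-C.adjMatrix) *ᵥ x := by
    intro x
    simp only [dotProduct, mulVec, Finset.mul_sum]
    refine Finset.sum_congr rfl fun i _ => Finset.sum_congr rfl fun j _ => ?_
    by_cases h : C.graph.Adj i j
    · have key : ∀ u : Fin (k + 3), (-1 : ℝ) ^ u.val * (-1) ^ (u + 1).val = -1 := by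
        intro u
        rw [← pow_add]
        refine Odd.neg_one_pow ?_
        have h1 : (u + 1).val = (u.val + 1) % (k + 3) := by simp [Fin.val_add]
        rw [h1]
        obtain ⟨p, hp⟩ := hk
        have := u.isLt
        by_cases hu : u.val + 1 < k + 3
        · rw [Nat.mod_eq_of_lt hu]
          exact ⟨u.val, by omega⟩
        · have h2 : u.val + 1 = k + 3 := by omega
          rw [h2, Nat.mod_self]
          exact ⟨p - 1, by omega⟩
      have h1 : (-1 : ℝ) ^ i.val * (-1) ^ j.val = -1 := by
        rcases hC.adj_iff.1 h with rfl | rfl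
        · exact key i
        · rw [mul_comm]
          exact key j
      simp only [D, LinearMap.coe_mk, AddHom.coe_mk, Matrix.neg_apply]
      linear_combination (x i * x j * C.adjMatrix i j) * h1
    · simp [C.adjMatrix_of_not_adj h]
  refine le_antisymm (negCount_le_of_forall_form C.isHermitian_adjMatrix _ D hD) ?_
  refine negCount_le_of_forall_form C.isHermitian_adjMatrix.neg C.isHermitian_adjMatrix D ?_
  intro x
  have := hD x
  simp only [neg_mulVec, dotProduct_neg] at this ⊢
  linarith

theorem IsSignedCycle.two_mul_negInertia_eq_iff (hC : C.IsSignedCycle) :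
    2 * C.negInertia + 2 = k + 3 ↔
      (C.Balanced → k + 3 ≡ 0 [MOD 4]) ∧ (¬ C.Balanced → k + 3 ≡ 2 [MOD 4]) := by
  classical
  simp only [Nat.ModEq]
  by_cases hk : Even (k + 3)
  swap
  -- For odd length both sides fail by parity.
  · rw [Nat.not_even_iff_odd] at hk
    obtain ⟨p, hp⟩ := hk
    by_cases hb : C.Balanced <;> simp only [hb, true_implies, not_true_eq_false, false_implies,
      not_false_eq_true, true_and, and_true] <;> omega
  have hbound := (C.graph.weight_bound C.adjMatrix C.isHermitian_adjMatrix C.isSupportOf_adjMatrix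
    (fun u v _ _ => by rw [hC.2]; exact SimpleGraph.cycleGraph_preconnected u v)).1
  rw [hC.totalWeight_eq, ← negInertia_eq] at hbound
  obtain ⟨hle, hker⟩ := negCount_add_negCount_neg_le C.isHermitian_adjMatrix
  rw [hC.negCount_neg_eq hk, ← negInertia_eq, Fintype.card_fin] at hle hker
  -- The two bounds leave `2 i₋ = m - 2` or `2 i₋ = m` for the even length `m`; the kernel decides
  -- which.
  have hzero : 2 * C.negInertia + 2 = k + 3 ↔ ∃ x, x ≠ 0 ∧ C.adjMatrix *ᵥ x = 0 := by
    rw [← hker]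
    obtain ⟨q, hq⟩ := hk
    omega
  obtain ⟨p, hp⟩ := hk
  rw [← two_mul] at hp
  rw [hzero, hC.exists_mulVec_eq_zero_iff hp]
  rcases Nat.even_or_odd p with hpe | hpo
  · rw [hpe.neg_one_pow, ← hC.balanced_iff]
    obtain ⟨q, hq⟩ := hpe
    by_cases hb : C.Balanced <;> simp only [hb, true_implies, not_true_eq_false, false_implies,
      not_false_eq_true, true_and, and_true, true_iff, false_iff] <;> omega
  · have hneq : ∏ i ∈ Finset.range (k + 3), C.cycleSign i = -1 ↔ ¬ C.Balanced := by
      rw [hC.balanced_iff]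
      rcases Int.units_eq_one_or (∏ i ∈ Finset.range (k + 3), C.cycleSign i) with h | h <;>
        rw [h] <;> decide
    rw [hpo.neg_one_pow, hneq]
    obtain ⟨q, hq⟩ := hpo
    by_cases hb : C.Balanced <;> simp only [hb, true_implies, not_true_eq_false, false_implies,
      not_false_eq_true, true_and, and_true, true_iff, false_iff] <;> omega

end Cycle

end SignedGraph

/-! ### Block sums and additivity of the inertia. -/

namespace Matrix

variable {V ι : Type*} {W : ι → Type*} {A : Matrix V V ℝ} {B : ∀ i, Matrix (W i) (W i) ℝ}
  {e : (Σ i, W i) ≃ V}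

/-- Up to the bijection `e` of the index types, `A` is the block diagonal matrix with the
blocks `B i`. -/
structure IsBlockSum (A : Matrix V V ℝ) (B : ∀ i, Matrix (W i) (W i) ℝ) (e : (Σ i, W i) ≃ V) :
    Prop where
  diag : ∀ i u v, A (e ⟨i, u⟩) (e ⟨i, v⟩) = B i u v
  off : ∀ i j u v, i ≠ j → A (e ⟨i, u⟩) (e ⟨j, v⟩) = 0

variable [Fintype V] [Fintype ι] [∀ i, Fintype (W i)]

theorem IsBlockSum.dotProduct_mulVec (h : IsBlockSum A B e) (x : V → ℝ) :
    x ⬝ᵥ A *ᵥ x = ∑ i, (fun u => x (e ⟨i, u⟩)) ⬝ᵥ B i *ᵥ fun u => x (e ⟨i, u⟩) := by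
  classical
  simp only [dotProduct, mulVec]
  rw [← Equiv.sum_comp e, Fintype.sum_sigma]
  refine Finset.sum_congr rfl fun i _ => Finset.sum_congr rfl fun u _ => ?_
  congr 1
  rw [← Equiv.sum_comp e, Fintype.sum_sigma, Finset.sum_eq_single i]
  · simp only [h.diag]
  · intro j _ hj
    simp [h.off i j u _ hj.symm]
  · simp

/-- The form is the sum of the forms of the blocks. Conditions forcing nonnegativity combine to the
upper bound, negative definite spaces to the lower bound. -/
theorem IsBlockSum.negCount_eq (h : IsBlockSum A B e) (hA : A.IsHermitian)
    (hB : ∀ i, (B i).IsHermitian) : negCount hA = ∑ i, negCount (hB i) := by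
  refine le_antisymm ?_ ?_
  · choose φ hφ using fun i => exists_nonneg_of_map_eq_zero (hB i)
    have := negCount_le_finrank hA (LinearMap.pi fun i =>
      φ i ∘ₗ LinearMap.funLeft ℝ ℝ fun u => e ⟨i, u⟩) fun x hx => by
        rw [h.dotProduct_mulVec]
        exact Finset.sum_nonneg fun i _ => hφ i _ (congrFun hx i)
    simpa [Module.finrank_pi_fintype] using this
  · choose f hf using fun i => exists_negDef (hB i)
    let F : (∀ i, Fin (negCount (hB i)) → ℝ) →ₗ[ℝ] (V → ℝ) :=
      LinearMap.pi fun v =>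
        LinearMap.proj (e.symm v).2 ∘ₗ f (e.symm v).1 ∘ₗ LinearMap.proj (e.symm v).1
    have := finrank_le_negCount hA F fun c hc => by
      rw [h.dotProduct_mulVec]
      have hF : ∀ i, (fun u => F c (e ⟨i, u⟩)) = f i (c i) := fun i => by
        ext u
        change f (e.symm (e ⟨i, u⟩)).1 (c (e.symm (e ⟨i, u⟩)).1) (e.symm (e ⟨i, u⟩)).2 = _
        rw [e.symm_apply_apply]
      simp only [hF]
      obtain ⟨j, hj⟩ := Function.ne_iff.1 hc
      refine Finset.sum_neg' (fun i _ => ?_) ⟨j, Finset.mem_univ _, hf j _ hj⟩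
      by_cases hi : c i = 0
      · simp [hi]
      · exact (hf i _ hi).le
    simpa [Module.finrank_pi_fintype] using this

end Matrix

/-! ### Connected 2-regular graphs are cycles. -/

namespace SimpleGraph

theorem exists_iso_cycleGraph {W : Type*} [Finite W] {G : SimpleGraph W} (hG : G.Connected)
    (h2 : ∀ v, G.deg v = 2) : ∃ m, 3 ≤ m ∧ Nonempty (cycleGraph m ≃g G) := by
  obtain ⟨v⟩ := hG.nonempty
  have hcyc : G.IsCycles := fun v _ => h2 v
  obtain ⟨p, hp, -⟩ := hcyc.exists_cycle_toSubgraph_verts_eq_connectedComponentSupp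
    (v := v) (c := G.connectedComponentMk v) rfl
    (Set.nonempty_of_ncard_ne_zero (by have := h2 v; unfold deg at this; omega))
  have h3 := hp.three_le_length
  obtain ⟨f⟩ := (cycleGraph_isContained_iff h3).2 ⟨v, p, hp, rfl⟩
  refine ⟨p.length, h3, ?_⟩
  -- Each vertex of the embedded cycle already has its two neighbours there. So the image is closed
  -- under adjacency and has no chords.
  have hadj : ∀ i y, G.Adj (f i) y → ∃ j, (cycleGraph p.length).Adj i j ∧ f j = y := by
    intro i y hy
    have hsub : f '' (cycleGraph p.length).neighborSet i ⊆ G.neighborSet (f i) := by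
      rintro _ ⟨j, hj, rfl⟩
      exact f.toHom.map_adj hj
    have heq := Set.eq_of_subset_of_ncard_le hsub (by
      have h1 := Set.ncard_image_of_injective ((cycleGraph p.length).neighborSet i) f.injective
      exact (h2 (f i)).le.trans ((deg_cycleGraph h3 i).ge.trans h1.ge))
    have : y ∈ f '' (cycleGraph p.length).neighborSet i := heq ▸ hy
    exact this
  have hsurj : Function.Surjective f := by
    intro w
    refine (hG.preconnected (f ⟨0, by omega⟩) w).mem_of_closed (S := Set.range f) ?_ ⟨_, rfl⟩
    rintro _ y ⟨i, rfl⟩ hy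
    obtain ⟨j, -, hj⟩ := hadj i y hy
    exact ⟨j, hj⟩
  refine ⟨⟨Equiv.ofBijective f ⟨f.injective, hsurj⟩, ?_⟩⟩
  intro a b
  refine ⟨fun h => ?_, fun h => f.toHom.map_adj h⟩
  obtain ⟨j, hj, hjb⟩ := hadj a (f b) h
  rwa [f.injective hjb] at hj

end SimpleGraph

/-! ### Isomorphisms, disjoint unions and components in terms of adjacency matrices. -/

namespace SignedGraph

open Matrix

section Iso

variable {V W : Type*} {Γ : SignedGraph V} {Δ : SignedGraph W}

theorem adj_iff_adjMatrix_ne_zero {u v : V} : Γ.graph.Adj u v ↔ Γ.adjMatrix u v ≠ 0 :=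
  (Γ.isSupportOf_adjMatrix u v).symm

theorem adjMatrix_eq_sign {u v : V} (h : Γ.graph.Adj u v) :
    Γ.adjMatrix u v = ((Γ.sign u v h : ℤ) : ℝ) := by
  simp [adjMatrix, h]

/-- The matrix determines the signed graph: nonzero entries are the edges and their values the
signs. -/
theorem nonempty_iso_iff : Nonempty (Γ.Iso Δ) ↔
    ∃ e : V ≃ W, ∀ u v, Δ.adjMatrix (e u) (e v) = Γ.adjMatrix u v := by
  constructor
  · rintro ⟨f⟩
    refine ⟨f.toGraphIso.toEquiv, fun u v => ?_⟩
    by_cases h : Γ.graph.Adj u v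
    · rw [adjMatrix_eq_sign h, ← f.sign_eq u v h]
      exact adjMatrix_eq_sign (f.toGraphIso.map_rel_iff.2 h)
    · rw [Γ.adjMatrix_of_not_adj h, Δ.adjMatrix_of_not_adj]
      exact fun h' => h (f.toGraphIso.map_rel_iff.1 h')
  · rintro ⟨e, he⟩
    refine ⟨⟨⟨e, ?_⟩, fun u v h => ?_⟩⟩
    · intro u v
      rw [adj_iff_adjMatrix_ne_zero, he, adj_iff_adjMatrix_ne_zero]
    · have h' : Δ.graph.Adj (e u) (e v) := by
        rw [adj_iff_adjMatrix_ne_zero, he, ← adj_iff_adjMatrix_ne_zero]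
        exact h
      have := he u v
      rw [adjMatrix_eq_sign h, adjMatrix_eq_sign h'] at this
      exact Units.ext (Int.cast_injective this)

end Iso

section DisjointUnion

variable {ι : Type*} {W : ι → Type*} (C : ∀ i, SignedGraph (W i))

theorem disjointUnion_adj_same {i : ι} {u v : W i} :
    (disjointUnion C).graph.Adj ⟨i, u⟩ ⟨i, v⟩ ↔ (C i).graph.Adj u v :=
  ⟨fun ⟨_, h⟩ => h, fun h => ⟨rfl, h⟩⟩

theorem isBlockSum_disjointUnion :
    IsBlockSum (disjointUnion C).adjMatrix (fun i => (C i).adjMatrix) (Equiv.refl _) where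
  diag i u v := by
    by_cases h : (C i).graph.Adj u v
    · rw [adjMatrix_eq_sign h]
      exact adjMatrix_eq_sign ((disjointUnion_adj_same C).2 h)
    · rw [(C i).adjMatrix_of_not_adj h]
      exact adjMatrix_of_not_adj _ fun h' => h ((disjointUnion_adj_same C).1 h')
  off i j u v hij := adjMatrix_of_not_adj _ fun ⟨h, _⟩ => hij h

theorem nonempty_iso_disjointUnion_iff {V : Type*} {Γ : SignedGraph V} :
    Nonempty (Γ.Iso (disjointUnion C)) ↔
      ∃ e, IsBlockSum Γ.adjMatrix (fun i => (C i).adjMatrix) e := by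
  rw [nonempty_iso_iff]
  constructor
  · rintro ⟨e, he⟩
    refine ⟨e.symm, fun i u v => ?_, fun i j u v hij => ?_⟩
    · rw [← he]
      simpa using (isBlockSum_disjointUnion C).diag i u v
    · rw [← he]
      simpa using (isBlockSum_disjointUnion C).off i j u v hij
  · rintro ⟨e, he⟩
    refine ⟨e.symm, fun u v => ?_⟩
    obtain ⟨⟨i, a⟩, rfl⟩ := e.surjective u
    obtain ⟨⟨j, b⟩, rfl⟩ := e.surjective v
    rw [Equiv.symm_apply_apply, Equiv.symm_apply_apply]
    by_cases hij : i = j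
    · subst hij
      exact ((isBlockSum_disjointUnion C).diag i a b).trans (he.diag i a b).symm
    · exact ((isBlockSum_disjointUnion C).off i j a b hij).trans (he.off i j a b hij).symm

variable {C} {V : Type*} {Γ : SignedGraph V} {e : (Σ i, W i) ≃ V}

theorem adj_apply_iff_of_isBlockSum
    (h : IsBlockSum Γ.adjMatrix (fun i => (C i).adjMatrix) e) {i : ι} {u : W i} {x : V} :
    Γ.graph.Adj (e ⟨i, u⟩) x ↔ ∃ v, (C i).graph.Adj u v ∧ e ⟨i, v⟩ = x := by
  obtain ⟨⟨j, v⟩, rfl⟩ := e.surjective x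
  rw [adj_iff_adjMatrix_ne_zero]
  constructor
  · intro hne
    obtain rfl : i = j := by
      by_contra hij
      exact hne (h.off i j u v hij)
    rw [h.diag] at hne
    exact ⟨v, adj_iff_adjMatrix_ne_zero.2 hne, rfl⟩
  · rintro ⟨w, hw, hwe⟩
    rw [← hwe, h.diag]
    exact adj_iff_adjMatrix_ne_zero.1 hw

theorem deg_eq_of_isBlockSum (h : IsBlockSum Γ.adjMatrix (fun i => (C i).adjMatrix) e)
    (i : ι) (u : W i) : Γ.graph.deg (e ⟨i, u⟩) = (C i).graph.deg u := by
  have : Γ.graph.neighborSet (e ⟨i, u⟩) = (fun v => e ⟨i, v⟩) '' (C i).graph.neighborSet u := by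
    ext x
    exact adj_apply_iff_of_isBlockSum h
  rw [SimpleGraph.deg, this, Set.ncard_image_of_injective]
  · rfl
  · intro a b hab
    simpa using hab

theorem totalWeight_eq_of_isBlockSum [Fintype V] [Fintype ι] [∀ i, Fintype (W i)]
    (h : IsBlockSum Γ.adjMatrix (fun i => (C i).adjMatrix) e) :
    Γ.graph.totalWeight = ∑ i, (C i).graph.totalWeight := by
  rw [SimpleGraph.totalWeight, ← Equiv.sum_comp e, Fintype.sum_sigma]
  simp only [deg_eq_of_isBlockSum h]
  rfl

theorem negInertia_eq_of_isBlockSum [Fintype V] [Fintype ι] [∀ i, Fintype (W i)]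
    (h : IsBlockSum Γ.adjMatrix (fun i => (C i).adjMatrix) e) :
    Γ.negInertia = ∑ i, (C i).negInertia :=
  h.negCount_eq Γ.isHermitian_adjMatrix fun i => (C i).isHermitian_adjMatrix

theorem card_connectedComponent_of_isBlockSum
    (h : IsBlockSum Γ.adjMatrix (fun i => (C i).adjMatrix) e)
    (hC : ∀ i, (C i).graph.Connected) :
    Nat.card Γ.graph.ConnectedComponent = Nat.card ι := by
  let a : ∀ i, W i := fun i => (hC i).nonempty.some
  symm
  refine Nat.card_eq_of_bijective (fun i => Γ.graph.connectedComponentMk (e ⟨i, a i⟩)) ⟨?_, ?_⟩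
  · intro i j hij
    have hr := SimpleGraph.ConnectedComponent.exact hij
    have hmem := hr.mem_of_closed (S := {x | (e.symm x).1 = i}) ?_ (by simp)
    · simpa using hmem.symm
    · intro x y hx hxy
      obtain ⟨⟨j, b⟩, rfl⟩ := e.surjective x
      obtain ⟨c, -, rfl⟩ := (adj_apply_iff_of_isBlockSum h).1 hxy
      simpa using hx
  · intro c
    induction c using SimpleGraph.ConnectedComponent.ind with
    | _ v =>
    obtain ⟨⟨i, b⟩, rfl⟩ := e.surjective v
    refine ⟨i, SimpleGraph.ConnectedComponent.sound ?_⟩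
    let f : (C i).graph →g Γ.graph :=
      ⟨fun u => e ⟨i, u⟩, fun {x y} hxy => (adj_apply_iff_of_isBlockSum h).2 ⟨y, hxy, rfl⟩⟩
    exact ((hC i).preconnected (a i) b).map f

end DisjointUnion

section Pullback

variable {V W : Type*} (Γ : SignedGraph V)

/-- The signed graph induced on a set of vertices. -/
def induce (s : Set V) : SignedGraph s where
  graph := Γ.graph.induce s
  sign u v h := Γ.sign u v h
  sign_comm u v h := Γ.sign_comm u v h

/-- The signed graph obtained by transporting the signs along a graph isomorphism. -/
def pullback {G : SimpleGraph W} (f : G ≃g Γ.graph) : SignedGraph W where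
  graph := G
  sign u v h := Γ.sign (f u) (f v) (f.map_rel_iff.2 h)
  sign_comm _ _ _ := Γ.sign_comm _ _ _

variable {Γ}

theorem adjMatrix_pullback {G : SimpleGraph W} (f : G ≃g Γ.graph) (u v : W) :
    (Γ.pullback f).adjMatrix u v = Γ.adjMatrix (f u) (f v) := by
  by_cases h : G.Adj u v
  · rw [adjMatrix_eq_sign (f.map_rel_iff.2 h)]
    exact adjMatrix_eq_sign (Γ := Γ.pullback f) h
  · rw [Γ.adjMatrix_of_not_adj fun h' => h (f.map_rel_iff.1 h')]
    exact adjMatrix_of_not_adj _ h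

theorem isBlockSum_pullback {ι κ : Type*} {W : ι → Type*} {U : κ → Type*}
    {C : ∀ i, SignedGraph (W i)} {e : (Σ i, W i) ≃ V}
    (h : IsBlockSum Γ.adjMatrix (fun i => (C i).adjMatrix) e) (g : κ ≃ ι)
    {G : ∀ j, SimpleGraph (U j)} (f : ∀ j, G j ≃g (C (g j)).graph) :
    IsBlockSum Γ.adjMatrix (fun j => ((C (g j)).pullback (f j)).adjMatrix)
      ((Equiv.sigmaCongr g fun j => (f j).toEquiv).trans e) where
  diag j u v := (h.diag (g j) (f j u) (f j v)).trans (adjMatrix_pullback (f j) u v).symm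
  off i j u v hij := h.off (g i) (g j) (f i u) (f j v) fun hg => hij (g.injective hg)

/-- An isomorphism is a block sum with a single block, so invariance under isomorphism follows from
additivity. -/
theorem isBlockSum_pullback_unit {G : SimpleGraph W} (f : G ≃g Γ.graph) :
    IsBlockSum Γ.adjMatrix (fun _ : Unit => (Γ.pullback f).adjMatrix)
      ((Equiv.uniqueSigma fun _ : Unit => W).trans f.toEquiv) where
  diag _ u v := (adjMatrix_pullback f u v).symm
  off _ _ _ _ hij := absurd rfl hij

theorem negInertia_pullback [Fintype V] [Fintype W] {G : SimpleGraph W} (f : G ≃g Γ.graph) :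
    (Γ.pullback f).negInertia = Γ.negInertia := by
  simpa using (negInertia_eq_of_isBlockSum (C := fun _ : Unit => Γ.pullback f)
    (isBlockSum_pullback_unit f)).symm

theorem totalWeight_pullback [Fintype V] [Fintype W] {G : SimpleGraph W} (f : G ≃g Γ.graph) :
    (Γ.pullback f).graph.totalWeight = Γ.graph.totalWeight := by
  simpa using (totalWeight_eq_of_isBlockSum (C := fun _ : Unit => Γ.pullback f)
    (isBlockSum_pullback_unit f)).symm

variable (Γ)

/-- A vertex set is the disjoint union of the connected components. -/
def sigmaSuppEquiv : (Σ c : Γ.graph.ConnectedComponent, c.supp) ≃ V :=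
  Equiv.sigmaFiberEquiv Γ.graph.connectedComponentMk

theorem isBlockSum_components : IsBlockSum Γ.adjMatrix
    (fun c : Γ.graph.ConnectedComponent => (Γ.induce c.supp).adjMatrix) Γ.sigmaSuppEquiv where
  diag _ _ _ := rfl
  off c d u v hcd := by
    refine Γ.adjMatrix_of_not_adj fun h => hcd ?_
    rw [← u.2, ← v.2]
    exact SimpleGraph.ConnectedComponent.sound h.reachable

theorem connected_induce_supp (c : Γ.graph.ConnectedComponent) :
    (Γ.induce c.supp).graph.Connected := c.connected_toSimpleGraph

end Pullback

end SignedGraph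

/-! ### From the weight to the stated formula, and the theorem. -/

namespace SimpleGraph

theorem Reachable.mem_support {V : Type*} {G : SimpleGraph V} {u v : V} (h : G.Reachable u v)
    (hne : u ≠ v) : u ∈ G.support := by
  obtain ⟨p⟩ := h
  cases p with
  | nil => exact absurd rfl hne
  | cons h _ => exact ⟨_, h⟩

theorem sum_deg_eq_twice_ncard_edgeSet {V : Type*} [Fintype V] (G : SimpleGraph V) :
    ∑ v, G.deg v = 2 * G.edgeSet.ncard := by
  classical
  have h := G.sum_degrees_eq_twice_card_edges
  rw [← coe_edgeFinset, Set.ncard_coe_finset, ← h]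
  exact Finset.sum_congr rfl fun v _ => by rw [← card_filter_adj, ← card_neighborFinset_eq_degree,
    neighborFinset_eq_filter]

theorem totalWeight_eq_of_deg_pos {V : Type*} [Fintype V] {G : SimpleGraph V}
    (h : ∀ v, 0 < G.deg v) : G.totalWeight =
      2 * (G.edgeSet.ncard : ℤ) - 3 * (Fintype.card V : ℤ) + ({v | G.deg v = 1}.ncard : ℤ) := by
  classical
  have hw : ∀ v, degWeight (G.deg v) = (G.deg v : ℤ) - 3 + if G.deg v = 1 then 1 else 0 := by
    intro v
    have hv := h v
    obtain h1 | h2 : G.deg v = 1 ∨ 2 ≤ G.deg v := by omega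
    · rw [h1]
      rfl
    · rw [degWeight_of_two_le h2, if_neg (by omega), add_zero]
  have hp : {v | G.deg v = 1}.ncard = (Finset.univ.filter fun v => G.deg v = 1).card := by
    rw [← Set.ncard_coe_finset]
    simp
  have hs : (∑ v, (G.deg v : ℤ)) = 2 * (G.edgeSet.ncard : ℤ) := by
    exact_mod_cast G.sum_deg_eq_twice_ncard_edgeSet
  rw [totalWeight, Finset.sum_congr rfl fun v _ => hw v, Finset.sum_add_distrib,
    Finset.sum_sub_distrib, hs, hp]
  simp [mul_comm]

end SimpleGraph

namespace SignedGraph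

variable {V : Type*} [Fintype V] (Γ : SignedGraph V)

theorem negInertia_eq_iff_of_deg_pos (h : ∀ v, 0 < Γ.graph.deg v) :
    (Γ.negInertia : ℝ) = ((Fintype.card V : ℝ) - (Γ.numPendant : ℝ)) / 2 - (Γ.cyclomatic : ℝ) ↔
      2 * (Γ.negInertia : ℤ) + 2 * (Nat.card Γ.graph.ConnectedComponent : ℤ) +
        Γ.graph.totalWeight = 0 := by
  have hp : Γ.numPendant = {v | Γ.graph.deg v = 1}.ncard := rfl
  rw [SimpleGraph.totalWeight_eq_of_deg_pos h, cyclomatic, ← hp, Nat.card_eq_fintype_card (α := V)]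
  rw [← Int.cast_inj (α := ℝ)]
  push_cast
  constructor <;> intro h <;> linarith

theorem weight_bound_of_connected (hΓ : Γ.graph.Connected) :
    0 ≤ 2 * (Γ.negInertia : ℤ) + 2 + Γ.graph.totalWeight ∧
      ((∃ v, Γ.graph.deg v ≠ 0 ∧ Γ.graph.deg v ≠ 2) →
        1 ≤ 2 * (Γ.negInertia : ℤ) + 2 + Γ.graph.totalWeight) :=
  Γ.graph.weight_bound Γ.adjMatrix Γ.isHermitian_adjMatrix Γ.isSupportOf_adjMatrix
    fun u v _ _ => hΓ.preconnected u v

theorem IsSignedCycle.weight_eq_zero_iff {m : ℕ} {C : SignedGraph (Fin m)}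
    (hC : C.IsSignedCycle) :
    2 * (C.negInertia : ℤ) + 2 + C.graph.totalWeight = 0 ↔
      (C.Balanced → m ≡ 0 [MOD 4]) ∧ (¬ C.Balanced → m ≡ 2 [MOD 4]) := by
  obtain ⟨k, rfl⟩ := Nat.exists_eq_add_of_le' hC.1
  rw [← hC.two_mul_negInertia_eq_iff, hC.totalWeight_eq]
  omega

theorem IsSignedCycle.connected {m : ℕ} {C : SignedGraph (Fin m)} (hC : C.IsSignedCycle) :
    C.graph.Connected := by
  obtain ⟨k, rfl⟩ := Nat.exists_eq_add_of_le' hC.1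
  rw [hC.2]
  exact SimpleGraph.cycleGraph_connected

/-- A connected signed graph without isolated vertices that attains the lower bound for the
number of negative eigenvalues is a cycle. -/
theorem exists_iso_cycleGraph_of_weight_eq_zero (hΓ : Γ.graph.Connected)
    (hdeg : ∀ v, 0 < Γ.graph.deg v)
    (h : 2 * (Γ.negInertia : ℤ) + 2 + Γ.graph.totalWeight = 0) :
    ∃ m, 3 ≤ m ∧ Nonempty (SimpleGraph.cycleGraph m ≃g Γ.graph) := by
  refine SimpleGraph.exists_iso_cycleGraph hΓ fun v => ?_
  by_contra hv
  have := (Γ.weight_bound_of_connected hΓ).2 ⟨v, (hdeg v).ne', hv⟩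
  omega

theorem deg_pos_of_two_le_ncard_supp
    (hcomp : ∀ c : Γ.graph.ConnectedComponent, 2 ≤ c.supp.ncard) (v : V) :
    0 < Γ.graph.deg v := by
  obtain ⟨u, hu, hne⟩ := Set.exists_ne_of_one_lt_ncard
    (s := (Γ.graph.connectedComponentMk v).supp) (hcomp _) v
  exact SimpleGraph.deg_pos_iff.2
    ((SimpleGraph.ConnectedComponent.exact hu).symm.mem_support hne.symm)

theorem weight_eq_sum_of_isBlockSum {ι : Type*} [Fintype ι] {W : ι → Type*}
    [∀ i, Fintype (W i)] {C : ∀ i, SignedGraph (W i)} {e : (Σ i, W i) ≃ V}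
    (h : Matrix.IsBlockSum Γ.adjMatrix (fun i => (C i).adjMatrix) e)
    (hC : ∀ i, (C i).graph.Connected) :
    2 * (Γ.negInertia : ℤ) + 2 * (Nat.card Γ.graph.ConnectedComponent : ℤ) +
        Γ.graph.totalWeight =
      ∑ i, (2 * ((C i).negInertia : ℤ) + 2 + (C i).graph.totalWeight) := by
  rw [negInertia_eq_of_isBlockSum h, card_connectedComponent_of_isBlockSum h hC,
    totalWeight_eq_of_isBlockSum h, Finset.sum_add_distrib, Finset.sum_add_distrib,
    ← Finset.mul_sum]
  simp [mul_comm]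

/-- By `weight_bound` the sum over the blocks has nonnegative terms. -/
theorem weight_eq_zero_of_isBlockSum {ι : Type*} [Fintype ι] {W : ι → Type*}
    [∀ i, Fintype (W i)] {C : ∀ i, SignedGraph (W i)} {e : (Σ i, W i) ≃ V}
    (h : Matrix.IsBlockSum Γ.adjMatrix (fun i => (C i).adjMatrix) e)
    (hC : ∀ i, (C i).graph.Connected)
    (hΓ : 2 * (Γ.negInertia : ℤ) + 2 * (Nat.card Γ.graph.ConnectedComponent : ℤ) +
      Γ.graph.totalWeight = 0) (i : ι) :
    2 * ((C i).negInertia : ℤ) + 2 + (C i).graph.totalWeight = 0 := by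
  rw [Γ.weight_eq_sum_of_isBlockSum h hC, Finset.sum_eq_zero_iff_of_nonneg fun i _ =>
    ((C i).weight_bound_of_connected (hC i)).1] at hΓ
  exact hΓ i (Finset.mem_univ i)

end SignedGraph

open SignedGraph in
theorem theorem4p2 {V : Type*} [Fintype V] (Γ : SignedGraph V) (n : ℕ)
    (hn : Fintype.card V = n)
    (hcomp : ∀ c : Γ.graph.ConnectedComponent, 2 ≤ c.supp.ncard) :
    (Γ.negInertia : ℝ) = ((n : ℝ) - (Γ.numPendant : ℝ)) / 2 - (Γ.cyclomatic : ℝ) ↔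
      ∃ (t : ℕ) (m : Fin t → ℕ) (C : ∀ i : Fin t, SignedGraph (Fin (m i))),
        (∀ i, (C i).IsSignedCycle) ∧
        ∑ i, m i = n ∧
        Nonempty (Γ.Iso (SignedGraph.disjointUnion C)) ∧
        ∀ i, ((C i).Balanced → m i ≡ 0 [MOD 4]) ∧ (¬ (C i).Balanced → m i ≡ 2 [MOD 4]) := by
  subst hn
  have hdeg := Γ.deg_pos_of_two_le_ncard_supp hcomp
  rw [Γ.negInertia_eq_iff_of_deg_pos hdeg]
  constructor
  · intro h
    have : Fintype Γ.graph.ConnectedComponent := Fintype.ofFinite _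
    have : ∀ c : Γ.graph.ConnectedComponent, Fintype c.supp := fun c => Fintype.ofFinite _
    have hsum := Γ.isBlockSum_components
    have hz := Γ.weight_eq_zero_of_isBlockSum
      (C := fun c : Γ.graph.ConnectedComponent => Γ.induce c.supp) hsum Γ.connected_induce_supp h
    have hdegc : ∀ (c : Γ.graph.ConnectedComponent) (v : c.supp),
        0 < (Γ.induce c.supp).graph.deg v := fun c v => by
      rw [← deg_eq_of_isBlockSum (C := fun c => Γ.induce c.supp) hsum c v]
      exact hdeg _
    have hex : ∀ c : Γ.graph.ConnectedComponent,
        ∃ m, 3 ≤ m ∧ Nonempty (SimpleGraph.cycleGraph m ≃g (Γ.induce c.supp).graph) := fun c =>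
      (Γ.induce c.supp).exists_iso_cycleGraph_of_weight_eq_zero (Γ.connected_induce_supp c)
        (hdegc c) (hz c)
    choose k hk hf using hex
    let f := fun c => (hf c).some
    obtain ⟨t, ⟨g⟩⟩ := Finite.exists_equiv_fin Γ.graph.ConnectedComponent
    -- Each component is replaced by a standard cycle carrying the transported signs, and the
    -- components are renumbered by `Fin t`.
    have he := isBlockSum_pullback (C := fun c => Γ.induce c.supp) hsum g.symm fun i => f (g.symm i)
    have hC : ∀ i, ((Γ.induce (g.symm i).supp).pullback (f (g.symm i))).IsSignedCycle :=
      fun i => ⟨hk _, rfl⟩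
    refine ⟨t, fun i => k (g.symm i), _, hC, ?_,
      (nonempty_iso_disjointUnion_iff _).2 ⟨_, he⟩, fun i => ?_⟩
    · rw [← Fintype.card_congr ((Equiv.sigmaCongr g.symm fun i => (f (g.symm i)).toEquiv).trans
        Γ.sigmaSuppEquiv)]
      simp
    · rw [← (hC i).weight_eq_zero_iff, negInertia_pullback, totalWeight_pullback]
      exact hz _
  · rintro ⟨t, m, C, hC, -, hiso, hmod⟩
    obtain ⟨e, he⟩ := (nonempty_iso_disjointUnion_iff C).1 hiso
    rw [Γ.weight_eq_sum_of_isBlockSum he fun i => (hC i).connected]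
    exact Finset.sum_eq_zero fun i _ => (hC i).weight_eq_zero_iff.2 (hmod i)
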